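/- Let $(\mathcal M,\tau)$ be a tracial $\mathrm W^*$-algebra (a von Neumann algebra with a faithful normal tracial state), let $\mathcal P\subseteq\mathcal M$ be a (unital) $\mathrm W^*$-subalgebra, and write $\|a\|_2=\tau(a^*a)^{1/2}$. Let $\mathbf x=(x_i)_{i\in I}$ be a tuple of self-adjoint elements that generates $\mathcal M$ as a von Neumann algebra, where $I$ is an arbitrary index set, and let $R_i>0$ with $\|x_i\|\le R_i$. Let $\Omega$ be a probability space and, for each $k\in\mathbb N$, let $n(k)\ge 1$ and let $\mathbf X^{(k)}=(X^{(k)}_i)_{i\in I}$ be a tuple of random self-adjoint $n(k)\times n(k)$ complex matrices on $\Omega$ with $\|X^{(k)}_i\|\le R_i$ almost surely. Let $\tau_n=\frac1n\operatorname{Tr}$ and assume that $\tau_{n(k)}(p(\mathbf X^{(k)}))\to\tau(p(\mathbf x))$ in probability as $k\to\infty$ for every non-commutative polynomial $p\in\mathbb C\langle t_i:i\in I\rangle$. For tracial algebras $(A_k,\tau_k)$ and a free ultrafilter $\omega$ on $\mathbb N$, let $\prod_{k\to\omega}A_k$ be the tracial ultraproduct, that is, the $*$-algebra of norm-bounded sequences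 $(a_k)_k$, $a_k\in A_k$, modulo those with $\lim_{k\to\omega}\tau_k(a_k^*a_k)=0$, with trace $[(a_k)_k]\mapsto\lim_{k\to\omega}\tau_k(a_k)$. It is applied to $M_{n(k)}(\mathbb C)$ with the trace $\tau_{n(k)}$, and to $L^\infty(\Omega,M_{n(k)}(\mathbb C))$ with the trace $f\mapsto\mathbb E[\tau_{n(k)}(f)]$. Let $$\iota_\omega:\prod_{k\to\omega}M_{n(k)}(\mathbb C)\to\prod_{k\to\omega}L^\infty(\Omega,M_{n(k)}(\mathbb C))$$ be the inclusion induced by viewing matrices as constant functions on $\Omega$. Then there is a unique trace-preserving conditional expectation $E_{\mathcal P}:\mathcal M\to\mathcal P$. For every free ultrafilter $\omega$ on $\mathbb N$ there are a unique trace-preserving unital $*$-homomorphism $\rho_\omega:\mathcal M\to\prod_{k\to\omega}L^\infty(\Omega,M_{n(k)}(\mathbb C))$ with $\rho_\omega(x_i)=[(X^{(k)}_i)_k]$ for all $i\in I$, and a unique trace-preserving conditional expectation $E_\omega:\prod_{k\to\omega}L^\infty(\Omega,M_{n(k)}(\mathbb C))\to\prod_{k\to\omega}M_{n(k)}(\mathbb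 C)$ (with respect to $\iota_\omega$). Moreover, the following are equivalent: 1. (External averaging property) For every non-commutative polynomial $p$, $$\lim_{k\to\infty}\big\|\mathbb E[p(\mathbf X^{(k)})]\big\|_2=\big\|E_{\mathcal P}[p(\mathbf x)]\big\|_2,$$ where the norm on the left is the $2$-norm of $(M_{n(k)}(\mathbb C),\tau_{n(k)})$. 2. For every free ultrafilter $\omega$ on $\mathbb N$, $$\rho_\omega(\mathcal P)=\rho_\omega(\mathcal M)\cap\iota_\omega\Big(\prod_{k\to\omega}M_{n(k)}(\mathbb C)\Big)$$ and $\iota_\omega\circ E_\omega\circ\rho_\omega=\rho_\omega\circ E_{\mathcal P}$ on $\mathcal M$. -/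

import Mathlib

open MeasureTheory Filter
open scoped ComplexOrder ENNReal Topology Matrix.Norms.L2Operator

noncomputable section

/-- A tracial state on a unital complex `*`-algebra: a linear functional `τ` with `τ 1 = 1`,
`τ (a* a) ≥ 0` and `τ (a b) = τ (b a)`. -/
structure TracialState (A : Type*) [Ring A] [StarRing A] [Algebra ℂ A] extends A →ₗ[ℂ] ℂ where
  map_one' : toFun 1 = 1
  nonneg' : ∀ a, 0 ≤ toFun (star a * a)
  tracial' : ∀ a b, toFun (a * b) = toFun (b * a)

namespace TracialState

section Basic

variable {A : Type*} [Ring A] [StarRing A] [Algebra ℂ A]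

instance : CoeFun (TracialState A) (fun _ => A → ℂ) := ⟨fun τ => τ.toLinearMap⟩

theorem map_one (τ : TracialState A) : τ 1 = 1 := τ.map_one'
theorem nonneg (τ : TracialState A) (a : A) : 0 ≤ τ (star a * a) := τ.nonneg' a
theorem tracial (τ : TracialState A) (a b : A) : τ (a * b) = τ (b * a) := τ.tracial' a b

/-- The `2`-norm `‖a‖₂ = τ(a* a)^{1/2}`. -/
def twoNorm (τ : TracialState A) (a : A) : ℝ := √(τ (star a * a)).re

/-- `τ` is faithful: `τ (a* a) = 0` only for `a = 0`. -/
def IsFaithful (τ : TracialState A) : Prop := ∀ a : A, τ (star a * a) = 0 → a = 0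

end Basic

section CStar

variable {A : Type*} [CStarAlgebra A] (τ : TracialState A)

theorem exists_seminorm_facts :
    (∀ a b, τ.twoNorm (a + b) ≤ τ.twoNorm a + τ.twoNorm b) ∧
    (∀ a b, τ.twoNorm (a * b) ≤ ‖a‖ * τ.twoNorm b) ∧
    (∀ a, ‖τ a‖ ≤ τ.twoNorm a) ∧ (∀ a, τ.twoNorm a ≤ ‖a‖) := by
  let _ := CStarAlgebra.spectralOrder A
  have _ := CStarAlgebra.spectralOrderedRing A
  let f : A →ₚ[ℂ] ℂ := PositiveLinearMap.mk₀ τ.toLinearMap (by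
    intro a ha
    obtain ⟨b, rfl⟩ := (CStarAlgebra.nonneg_iff_eq_star_mul_self (a := a)).1 ha
    exact τ.nonneg b)
  have hf : ∀ a, f a = τ a := fun _ => rfl
  have h2 : ∀ a, τ.twoNorm a = ‖f.toPreGNS a‖ := by
    intro a
    rw [PositiveLinearMap.preGNS_norm_def]
    rfl
  have h1 : ‖f.toPreGNS 1‖ = 1 := by
    rw [← h2, twoNorm]
    simp [τ.map_one]
  have hmul : ∀ a b, τ.twoNorm (a * b) ≤ ‖a‖ * τ.twoNorm b := by
    intro a b
    have h := (f.leftMulMapPreGNS a).le_opNorm (f.toPreGNS b)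
    have hn : ‖f.leftMulMapPreGNS a‖ ≤ ‖a‖ :=
      LinearMap.mkContinuous_norm_le _ (norm_nonneg a) _
    rw [h2, h2]
    refine le_trans ?_ (mul_le_mul_of_nonneg_right hn (norm_nonneg _))
    simpa using h
  refine ⟨?_, hmul, ?_, ?_⟩
  · intro a b
    rw [h2, h2, h2, map_add]
    exact norm_add_le _ _
  · intro a
    have h := norm_inner_le_norm (𝕜 := ℂ) (f.toPreGNS 1) (f.toPreGNS a)
    rw [PositiveLinearMap.preGNS_inner_def, h1, one_mul] at h
    rw [h2]
    simpa [hf] using h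
  · intro a
    have h := hmul a 1
    rwa [mul_one, h2 1, h1, mul_one] at h

theorem twoNorm_nonneg {A : Type*} [Ring A] [StarRing A] [Algebra ℂ A] (τ : TracialState A)
    (a : A) : 0 ≤ τ.twoNorm a := Real.sqrt_nonneg _

theorem twoNorm_add_le (a b : A) : τ.twoNorm (a + b) ≤ τ.twoNorm a + τ.twoNorm b :=
  τ.exists_seminorm_facts.1 a b

theorem twoNorm_mul_le (a b : A) : τ.twoNorm (a * b) ≤ ‖a‖ * τ.twoNorm b :=
  τ.exists_seminorm_facts.2.1 a b

theorem norm_apply_le_twoNorm (a : A) : ‖τ a‖ ≤ τ.twoNorm a := τ.exists_seminorm_facts.2.2.1 a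

theorem twoNorm_le_norm (a : A) : τ.twoNorm a ≤ ‖a‖ := τ.exists_seminorm_facts.2.2.2 a

theorem norm_apply_le (a : A) : ‖τ a‖ ≤ ‖a‖ :=
  (τ.norm_apply_le_twoNorm a).trans (τ.twoNorm_le_norm a)

theorem twoNorm_star (a : A) : τ.twoNorm (star a) = τ.twoNorm a := by
  rw [twoNorm, twoNorm, star_star, τ.tracial]

theorem twoNorm_mul_le' (a b : A) : τ.twoNorm (a * b) ≤ τ.twoNorm a * ‖b‖ := by
  rw [← twoNorm_star, star_mul, mul_comm]
  refine (τ.twoNorm_mul_le _ _).trans ?_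
  rw [twoNorm_star, norm_star]

end CStar

end TracialState

/-! ### The C*-algebra `L^∞(Ω, A)` -/

/-- `L^∞(Ω, A)`: essentially bounded random variables with values in `A`, modulo almost sure
equality. -/
def Linfty {Ω : Type*} [MeasurableSpace Ω] (μ : Measure Ω) (A : Type*) [CStarAlgebra A] : Type _ :=
  Lp A ∞ μ

namespace Linfty

variable {Ω : Type*} [MeasurableSpace Ω] {μ : Measure Ω} {A : Type*} [CStarAlgebra A]

instance : NormedAddCommGroup (Linfty μ A) := inferInstanceAs (NormedAddCommGroup (Lp A ∞ μ))
instance : NormedSpace ℂ (Linfty μ A) := inferInstanceAs (NormedSpace ℂ (Lp A ∞ μ))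
instance : CompleteSpace (Linfty μ A) := inferInstanceAs (CompleteSpace (Lp A ∞ μ))
instance : InvolutiveStar (Linfty μ A) := inferInstanceAs (InvolutiveStar (Lp A ∞ μ))

/-- A representative `Ω → A` of an element of `L^∞(Ω, A)`. -/
def toFn (f : Linfty μ A) : Ω → A := AEEqFun.cast (Subtype.val (p := fun g => g ∈ Lp A ∞ μ) f)

instance : CoeFun (Linfty μ A) (fun _ => Ω → A) := ⟨toFn⟩

theorem aesm (f : Linfty μ A) : AEStronglyMeasurable f μ := Lp.aestronglyMeasurable (E := A) f

theorem ext_ae {f g : Linfty μ A} (h : f =ᵐ[μ] g) : f = g := Lp.ext (E := A) h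

theorem ae_norm_le (f : Linfty μ A) : ∀ᵐ w ∂μ, ‖f w‖ ≤ ‖f‖ := by
  have h : ∀ᵐ w ∂μ, ‖f w‖ₑ ≤ eLpNormEssSup f μ := ae_le_eLpNormEssSup
  have hn : ‖f‖ = (eLpNormEssSup f μ).toReal := by
    rw [← eLpNorm_exponent_top]; rfl
  have ht : eLpNormEssSup f μ ≠ ∞ := by
    rw [← eLpNorm_exponent_top]; exact Lp.eLpNorm_ne_top (E := A) f
  filter_upwards [h] with w hw
  rw [hn, ← toReal_enorm]
  exact ENNReal.toReal_mono ht hw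

theorem norm_le {f : Linfty μ A} {C : ℝ} (hC : 0 ≤ C) (h : ∀ᵐ w ∂μ, ‖f w‖ ≤ C) : ‖f‖ ≤ C := by
  have hn : ‖f‖ = (eLpNormEssSup f μ).toReal := by
    rw [← eLpNorm_exponent_top]; rfl
  rw [hn]
  exact ENNReal.toReal_le_of_le_ofReal hC (eLpNormEssSup_le_of_ae_bound h)

/-- The class in `L^∞(Ω, A)` of an almost surely bounded random variable. -/
def ofBounded (f : Ω → A) (hf : AEStronglyMeasurable f μ) (hb : ∃ C : ℝ, ∀ᵐ w ∂μ, ‖f w‖ ≤ C) :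
    Linfty μ A :=
  MemLp.toLp f (p := ∞) (μ := μ)
    ⟨hf, by
      obtain ⟨C, hC⟩ := hb
      rw [eLpNorm_exponent_top]
      exact eLpNormEssSup_lt_top_of_ae_bound hC⟩

theorem coeFn_ofBounded (f : Ω → A) (hf : AEStronglyMeasurable f μ)
    (hb : ∃ C : ℝ, ∀ᵐ w ∂μ, ‖f w‖ ≤ C) : ofBounded f hf hb =ᵐ[μ] f :=
  MemLp.coeFn_toLp _

instance : Mul (Linfty μ A) where
  mul f g := ofBounded (fun w => f w * g w) (f.aesm.mul g.aesm) ⟨‖f‖ * ‖g‖, by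
    filter_upwards [f.ae_norm_le, g.ae_norm_le] with w h1 h2
    exact (norm_mul_le _ _).trans (mul_le_mul h1 h2 (norm_nonneg _) (norm_nonneg _))⟩

instance : One (Linfty μ A) where
  one := ofBounded (fun _ => 1) aestronglyMeasurable_const ⟨‖(1 : A)‖, by simp⟩

theorem coeFn_mul (f g : Linfty μ A) : (f * g : Linfty μ A) =ᵐ[μ] fun w => f w * g w :=
  coeFn_ofBounded _ _ _
theorem coeFn_one : (1 : Linfty μ A) =ᵐ[μ] fun _ => (1 : A) := coeFn_ofBounded _ _ _
theorem coeFn_add (f g : Linfty μ A) : (f + g : Linfty μ A) =ᵐ[μ] fun w => f w + g w :=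
  Lp.coeFn_add (E := A) f g
theorem coeFn_zero : (0 : Linfty μ A) =ᵐ[μ] fun _ => (0 : A) := Lp.coeFn_zero A ∞ μ
theorem coeFn_smul (c : ℂ) (f : Linfty μ A) : (c • f : Linfty μ A) =ᵐ[μ] fun w => c • f w :=
  Lp.coeFn_smul (E := A) c f
theorem coeFn_star (f : Linfty μ A) : (star f : Linfty μ A) =ᵐ[μ] fun w => star (f w) :=
  Lp.coeFn_star (R := A) f

instance : Ring (Linfty μ A) :=
  { (inferInstance : AddCommGroup (Linfty μ A)), (inferInstance : Mul (Linfty μ A)),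
    (inferInstance : One (Linfty μ A)) with
    mul_assoc := fun f g h => ext_ae (by
      filter_upwards [coeFn_mul (f * g) h, coeFn_mul f g, coeFn_mul f (g * h), coeFn_mul g h]
        with w h1 h2 h3 h4
      rw [h1, h2, h3, h4, mul_assoc])
    one_mul := fun f => ext_ae (by
      filter_upwards [coeFn_mul 1 f, coeFn_one (μ := μ) (A := A)] with w h1 h2
      rw [h1, h2, one_mul])
    mul_one := fun f => ext_ae (by
      filter_upwards [coeFn_mul f 1, coeFn_one (μ := μ) (A := A)] with w h1 h2
      rw [h1, h2, mul_one])
    zero_mul := fun f => ext_ae (by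
      filter_upwards [coeFn_mul 0 f, coeFn_zero (μ := μ) (A := A)] with w h1 h2
      rw [h1, h2, zero_mul])
    mul_zero := fun f => ext_ae (by
      filter_upwards [coeFn_mul f 0, coeFn_zero (μ := μ) (A := A)] with w h1 h2
      rw [h1, h2, mul_zero])
    left_distrib := fun f g h => ext_ae (by
      filter_upwards [coeFn_mul f (g + h), coeFn_add g h, coeFn_add (f * g) (f * h),
        coeFn_mul f g, coeFn_mul f h] with w h1 h2 h3 h4 h5
      rw [h1, h2, h3, h4, h5, mul_add])
    right_distrib := fun f g h => ext_ae (by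
      filter_upwards [coeFn_mul (f + g) h, coeFn_add f g, coeFn_add (f * h) (g * h),
        coeFn_mul f h, coeFn_mul g h] with w h1 h2 h3 h4 h5
      rw [h1, h2, h3, h4, h5, add_mul]) }

instance : CStarAlgebra (Linfty μ A) :=
  { (inferInstance : NormedAddCommGroup (Linfty μ A)), (inferInstance : Ring (Linfty μ A)),
    (inferInstance : InvolutiveStar (Linfty μ A)), (inferInstance : CompleteSpace (Linfty μ A)) with
    norm_mul_le := fun f g => norm_le (by positivity) (by
      filter_upwards [coeFn_mul f g, f.ae_norm_le, g.ae_norm_le] with w h h1 h2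
      rw [h]
      exact (norm_mul_le _ _).trans (mul_le_mul h1 h2 (norm_nonneg _) (norm_nonneg _)))
    star_mul := fun f g => ext_ae (by
      filter_upwards [coeFn_star (f * g), coeFn_mul f g, coeFn_mul (star g) (star f),
        coeFn_star f, coeFn_star g] with w h1 h2 h3 h4 h5
      rw [h1, h2, h3, h4, h5, star_mul])
    star_add := fun f g => ext_ae (by
      filter_upwards [coeFn_star (f + g), coeFn_add f g, coeFn_add (star f) (star g),
        coeFn_star f, coeFn_star g] with w h1 h2 h3 h4 h5
      rw [h1, h2, h3, h4, h5, star_add])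
    norm_mul_self_le := fun f => by
      rw [← sq, ← Real.le_sqrt (norm_nonneg _) (norm_nonneg _)]
      refine norm_le (Real.sqrt_nonneg _) ?_
      filter_upwards [coeFn_star f, coeFn_mul (star f) f, (star f * f).ae_norm_le] with w h1 h2 h3
      rw [h2, h1, CStarRing.norm_star_mul_self] at h3
      exact Real.le_sqrt_of_sq_le (by rw [sq]; exact h3)
    smul := fun c f => c • f
    algebraMap :=
      { toFun := fun c => c • (1 : Linfty μ A)
        map_one' := one_smul _ _
        map_zero' := zero_smul _ _
        map_add' := fun a b => add_smul _ _ _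
        map_mul' := fun a b => ext_ae (by
          filter_upwards [coeFn_smul (a * b) (1 : Linfty μ A), coeFn_smul a (1 : Linfty μ A),
            coeFn_smul b (1 : Linfty μ A), coeFn_mul (a • (1 : Linfty μ A)) (b • 1),
            coeFn_one (μ := μ) (A := A)] with w h1 h2 h3 h4 h5
          rw [h1, h4, h2, h3, h5, smul_mul_smul_comm, one_mul]) }
    commutes' := fun c f => ext_ae (by
      filter_upwards [coeFn_smul c (1 : Linfty μ A), coeFn_mul (c • (1 : Linfty μ A)) f,
        coeFn_mul f (c • (1 : Linfty μ A)), coeFn_one (μ := μ) (A := A)] with w h1 h2 h3 h4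
      change (c • (1 : Linfty μ A) * f : Linfty μ A) w = (f * c • (1 : Linfty μ A) : Linfty μ A) w
      rw [h2, h3, h1, h4]
      simp)
    smul_def' := fun c f => ext_ae (by
      filter_upwards [coeFn_smul c (1 : Linfty μ A), coeFn_mul (c • (1 : Linfty μ A)) f,
        coeFn_smul c f, coeFn_one (μ := μ) (A := A)] with w h1 h2 h3 h4
      change (c • f : Linfty μ A) w = (c • (1 : Linfty μ A) * f : Linfty μ A) w
      rw [h2, h3, h1, h4]
      simp)
    norm_smul_le := fun c f => (norm_smul_le c f :)
    star_smul := fun c f => ext_ae (by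
      filter_upwards [coeFn_star (c • f), coeFn_smul c f, coeFn_smul (star c) (star f),
        coeFn_star f] with w h1 h2 h3 h4
      change (star (c • f) : Linfty μ A) w = (star c • star f : Linfty μ A) w
      rw [h1, h2, h3, h4, star_smul]) }


/-- The canonical inclusion `A → L^∞(Ω, A)` as deterministic (constant) functions. -/
def const (μ : Measure Ω) (A : Type*) [CStarAlgebra A] : A →⋆ₐ[ℂ] Linfty μ A where
  toFun a := ofBounded (fun _ => a) aestronglyMeasurable_const ⟨‖a‖, by simp⟩
  map_one' := rfl
  map_mul' a b := ext_ae (by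
    filter_upwards [coeFn_ofBounded (μ := μ) (fun _ => a) aestronglyMeasurable_const ⟨‖a‖, by simp⟩,
      coeFn_ofBounded (μ := μ) (fun _ => b) aestronglyMeasurable_const ⟨‖b‖, by simp⟩,
      coeFn_ofBounded (μ := μ) (fun _ => a * b) aestronglyMeasurable_const ⟨‖a * b‖, by simp⟩,
      coeFn_mul (μ := μ) (ofBounded (fun _ => a) aestronglyMeasurable_const ⟨‖a‖, by simp⟩)
        (ofBounded (fun _ => b) aestronglyMeasurable_const ⟨‖b‖, by simp⟩)] with w h1 h2 h3 h4
    rw [h3, h4, h1, h2])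
  map_zero' := ext_ae (by
    filter_upwards [coeFn_ofBounded (μ := μ) (fun _ => (0 : A)) aestronglyMeasurable_const
      ⟨‖(0 : A)‖, by simp⟩, coeFn_zero (μ := μ) (A := A)] with w h1 h2
    rw [h1, h2])
  map_add' a b := ext_ae (by
    filter_upwards [coeFn_ofBounded (μ := μ) (fun _ => a) aestronglyMeasurable_const ⟨‖a‖, by simp⟩,
      coeFn_ofBounded (μ := μ) (fun _ => b) aestronglyMeasurable_const ⟨‖b‖, by simp⟩,
      coeFn_ofBounded (μ := μ) (fun _ => a + b) aestronglyMeasurable_const ⟨‖a + b‖, by simp⟩,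
      coeFn_add (μ := μ) (ofBounded (fun _ => a) aestronglyMeasurable_const ⟨‖a‖, by simp⟩)
        (ofBounded (fun _ => b) aestronglyMeasurable_const ⟨‖b‖, by simp⟩)] with w h1 h2 h3 h4
    rw [h3, h4, h1, h2])
  commutes' c := ext_ae (by
    filter_upwards [coeFn_ofBounded (μ := μ) (fun _ => algebraMap ℂ A c) aestronglyMeasurable_const
      ⟨‖algebraMap ℂ A c‖, by simp⟩, coeFn_smul c (1 : Linfty μ A),
      coeFn_one (μ := μ) (A := A)] with w h1 h2 h3
    change _ = (c • (1 : Linfty μ A) : Linfty μ A) w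
    rw [h1, h2, h3, Algebra.algebraMap_eq_smul_one])
  map_star' a := ext_ae (by
    filter_upwards [coeFn_ofBounded (μ := μ) (fun _ => a) aestronglyMeasurable_const ⟨‖a‖, by simp⟩,
      coeFn_ofBounded (μ := μ) (fun _ => star a) aestronglyMeasurable_const ⟨‖star a‖, by simp⟩,
      coeFn_star (μ := μ) (ofBounded (fun _ => a) aestronglyMeasurable_const ⟨‖a‖, by simp⟩)]
      with w h1 h2 h3
    rw [h2, h3, h1])

theorem coeFn_const (a : A) : const μ A a =ᵐ[μ] fun _ => a :=
  coeFn_ofBounded (fun _ => a) aestronglyMeasurable_const ⟨‖a‖, by simp⟩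

theorem integrable [IsProbabilityMeasure μ] (f : Linfty μ A) : Integrable f μ :=
  Integrable.of_bound f.aesm ‖f‖ f.ae_norm_le

/-- The tracial state `f ↦ ∫ τ(f) dμ` on `L^∞(Ω, A)`. -/
def tracialState (μ : Measure Ω) [IsProbabilityMeasure μ] (τ : TracialState A) :
    TracialState (Linfty μ A) :=
  have hint : ∀ f : Linfty μ A, Integrable (fun w => τ (f w)) μ := fun f =>
    (τ.toLinearMap.mkContinuous 1 (fun a => by rw [one_mul]; exact τ.norm_apply_le a)
      ).integrable_comp f.integrable
  { toFun := fun f => ∫ w, τ (f w) ∂μ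
    map_add' := fun f g => by
      rw [← integral_add (hint f) (hint g)]
      refine integral_congr_ae ?_
      filter_upwards [coeFn_add f g] with w h
      rw [h, map_add]
    map_smul' := fun c f => by
      rw [RingHom.id_apply, ← integral_smul]
      refine integral_congr_ae ?_
      filter_upwards [coeFn_smul c f] with w h
      change τ ((c • f : Linfty μ A) w) = _
      rw [h, map_smul]
    map_one' := by
      have : (fun w => τ ((1 : Linfty μ A) w)) =ᵐ[μ] fun _ => (1 : ℂ) := by
        filter_upwards [coeFn_one (μ := μ) (A := A)] with w h
        rw [h, τ.map_one]
      change ∫ w, τ ((1 : Linfty μ A) w) ∂μ = 1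
      rw [integral_congr_ae this]
      simp
    nonneg' := fun f => by
      change 0 ≤ ∫ w, τ ((star f * f : Linfty μ A) w) ∂μ
      refine integral_nonneg_of_ae ?_
      filter_upwards [coeFn_mul (star f) f, coeFn_star f] with w h1 h2
      rw [h1, h2]
      exact τ.nonneg _
    tracial' := fun f g => by
      refine integral_congr_ae ?_
      filter_upwards [coeFn_mul f g, coeFn_mul g f] with w h1 h2
      rw [h1, h2, τ.tracial] }

theorem tracialState_const [IsProbabilityMeasure μ] (τ : TracialState A) (a : A) :
    tracialState μ τ (const μ A a) = τ a := by
  have h : (fun w => τ (const μ A a w)) =ᵐ[μ] fun _ => τ a := by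
    filter_upwards [coeFn_const (μ := μ) a] with w h
    rw [h]
  change ∫ w, τ (const μ A a w) ∂μ = τ a
  rw [integral_congr_ae h]
  simp

end Linfty

/-- The normalized trace `τ_n = (1/n) Tr` on `M_n(ℂ)`. -/
def matrixTrace (n : ℕ) [NeZero n] : TracialState (Matrix (Fin n) (Fin n) ℂ) where
  toLinearMap := ((n : ℂ)⁻¹) • Matrix.traceLinearMap (Fin n) ℂ ℂ
  map_one' := by
    have : (n : ℂ) ≠ 0 := Nat.cast_ne_zero.2 (NeZero.ne n)
    simp [this]
  nonneg' a := by
    have h : 0 ≤ (star a * a).trace := (Matrix.posSemidef_conjTranspose_mul_self a).trace_nonneg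
    have hn : (0 : ℂ) ≤ (n : ℂ)⁻¹ := by
      rw [show ((n : ℂ)⁻¹) = (((n : ℝ)⁻¹ : ℝ) : ℂ) by push_cast; rfl]
      exact Complex.zero_le_real.2 (by positivity)
    exact mul_nonneg hn h
  tracial' a b := congrArg (fun t => (n : ℂ)⁻¹ * t) (Matrix.trace_mul_comm a b)

/-! ### Tracial ultraproducts -/

section Ultraproduct

/-- Norm-bounded sequences `(a_k)` with `a_k ∈ A_k`. -/
def boundedSeq (A : ℕ → Type*) [∀ k, CStarAlgebra (A k)] : StarSubalgebra ℂ (∀ k, A k) where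
  carrier := {a | ∃ C : ℝ, ∀ k, ‖a k‖ ≤ C}
  mul_mem' := by
    rintro a b ⟨C, hC⟩ ⟨D, hD⟩
    exact ⟨C * D, fun k => (norm_mul_le _ _).trans
      (mul_le_mul (hC k) (hD k) (norm_nonneg _) ((norm_nonneg _).trans (hC k)))⟩
  add_mem' := by
    rintro a b ⟨C, hC⟩ ⟨D, hD⟩
    exact ⟨C + D, fun k => (norm_add_le _ _).trans (add_le_add (hC k) (hD k))⟩
  algebraMap_mem' c := ⟨‖c‖ * 1, fun k => by
    rw [Pi.algebraMap_apply, Algebra.algebraMap_eq_smul_one]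
    refine (norm_smul_le _ _).trans (mul_le_mul_of_nonneg_left ?_ (norm_nonneg _))
    rcases subsingleton_or_nontrivial (A k) with h | h
    · rw [Subsingleton.elim (1 : A k) 0, norm_zero]; exact zero_le_one
    · exact CStarRing.norm_one.le⟩
  star_mem' := by
    rintro a ⟨C, hC⟩
    exact ⟨C, fun k => by rw [Pi.star_apply, norm_star]; exact hC k⟩

variable {A : ℕ → Type*} [∀ k, CStarAlgebra (A k)] (τ : ∀ k, TracialState (A k)) (ω : Ultrafilter ℕ)

/-- The two-sided ideal of bounded sequences with `lim_{k → ω} ‖a_k‖₂ = 0`. -/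
def nullIdeal : Ideal (boundedSeq A) where
  carrier := {a | Tendsto (fun k => (τ k).twoNorm (a.1 k)) ω (𝓝 0)}
  add_mem' := by
    intro a b ha hb
    refine squeeze_zero (fun k => (τ k).twoNorm_nonneg _)
      (fun k => (τ k).twoNorm_add_le (a.1 k) (b.1 k)) ?_
    simpa using Tendsto.add ha hb
  zero_mem' := by
    have : (fun k => (τ k).twoNorm ((0 : boundedSeq A).1 k)) = fun _ => 0 := by
      funext k
      simp [TracialState.twoNorm]
    change Tendsto _ _ _
    rw [this]
    exact tendsto_const_nhds
  smul_mem' := by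
    rintro ⟨c, C, hC⟩ a ha
    refine squeeze_zero (fun k => (τ k).twoNorm_nonneg _) (fun k =>
      ((τ k).twoNorm_mul_le (c k) (a.1 k)).trans
        (mul_le_mul_of_nonneg_right (hC k) ((τ k).twoNorm_nonneg _))) ?_
    simpa using Tendsto.const_mul C ha

theorem mem_nullIdeal {a : boundedSeq A} :
    a ∈ nullIdeal τ ω ↔ Tendsto (fun k => (τ k).twoNorm (a.1 k)) ω (𝓝 0) := Iff.rfl

instance : (nullIdeal τ ω).IsTwoSided where
  mul_mem_of_left := by
    rintro a ⟨c, C, hC⟩ ha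
    refine squeeze_zero (fun k => (τ k).twoNorm_nonneg _) (fun k =>
      ((τ k).twoNorm_mul_le' (a.1 k) (c k)).trans
        (mul_le_mul_of_nonneg_left (hC k) ((τ k).twoNorm_nonneg _))) ?_
    simpa using Tendsto.mul_const C ha

/-- The tracial ultraproduct `∏_{k → ω} (A_k, τ_k)`: bounded sequences modulo those with
`lim_{k → ω} ‖a_k‖₂ = 0`. -/
def TracialUltraproduct : Type _ := boundedSeq A ⧸ nullIdeal τ ω

namespace TracialUltraproduct

instance : Ring (TracialUltraproduct τ ω) := inferInstanceAs (Ring (boundedSeq A ⧸ nullIdeal τ ω))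

instance : Algebra ℂ (TracialUltraproduct τ ω) :=
  inferInstanceAs (Algebra ℂ (boundedSeq A ⧸ nullIdeal τ ω))

/-- The quotient map as an algebra homomorphism. -/
def mkAlgHom : boundedSeq A →ₐ[ℂ] TracialUltraproduct τ ω := Ideal.Quotient.mkₐ ℂ (nullIdeal τ ω)

theorem mkAlgHom_surjective : Function.Surjective (mkAlgHom τ ω) :=
  Ideal.Quotient.mkₐ_surjective ℂ (nullIdeal τ ω)

theorem mkAlgHom_eq_iff {a b : boundedSeq A} :
    mkAlgHom τ ω a = mkAlgHom τ ω b ↔ a - b ∈ nullIdeal τ ω :=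
  Ideal.Quotient.mk_eq_mk_iff_sub_mem a b

theorem star_mem_nullIdeal {a : boundedSeq A} (h : a ∈ nullIdeal τ ω) :
    star a ∈ nullIdeal τ ω := by
  rw [mem_nullIdeal] at h ⊢
  refine h.congr fun k => ?_
  exact ((τ k).twoNorm_star (a.1 k)).symm

instance : Star (TracialUltraproduct τ ω) where
  star := Quotient.lift (s := Submodule.quotientRel (nullIdeal τ ω))
    (fun a => mkAlgHom τ ω (star a)) (by
      intro a b h
      have h' : mkAlgHom τ ω a = mkAlgHom τ ω b := Quotient.sound h
      rw [mkAlgHom_eq_iff] at h' ⊢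
      have hs : star a - star b = star (a - b) := Subtype.ext (star_sub a.1 b.1).symm
      rw [hs]
      exact star_mem_nullIdeal τ ω h')

theorem star_mkAlgHom (a : boundedSeq A) :
    star (mkAlgHom τ ω a) = mkAlgHom τ ω (star a) := rfl

instance : StarRing (TracialUltraproduct τ ω) where
  star_involutive u := by
    obtain ⟨a, rfl⟩ := mkAlgHom_surjective τ ω u
    rw [star_mkAlgHom, star_mkAlgHom, star_star]
  star_mul u v := by
    obtain ⟨a, rfl⟩ := mkAlgHom_surjective τ ω u
    obtain ⟨b, rfl⟩ := mkAlgHom_surjective τ ω v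
    rw [← map_mul, star_mkAlgHom, star_mkAlgHom, star_mkAlgHom, star_mul, map_mul]
  star_add u v := by
    obtain ⟨a, rfl⟩ := mkAlgHom_surjective τ ω u
    obtain ⟨b, rfl⟩ := mkAlgHom_surjective τ ω v
    rw [← map_add, star_mkAlgHom, star_mkAlgHom, star_mkAlgHom, star_add, map_add]

instance : StarModule ℂ (TracialUltraproduct τ ω) where
  star_smul c u := by
    obtain ⟨a, rfl⟩ := mkAlgHom_surjective τ ω u
    rw [← map_smul, star_mkAlgHom, star_mkAlgHom, star_smul, map_smul]

/-- The class `[a_k]` of a bounded sequence, as a unital `*`-homomorphism. -/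
def mk : boundedSeq A →⋆ₐ[ℂ] TracialUltraproduct τ ω :=
  { mkAlgHom τ ω with map_star' := fun a => (star_mkAlgHom τ ω a).symm }

theorem mk_surjective : Function.Surjective (mk τ ω) := mkAlgHom_surjective τ ω

theorem mk_eq_iff {a b : boundedSeq A} : mk τ ω a = mk τ ω b ↔
    Tendsto (fun k => (τ k).twoNorm (a.1 k - b.1 k)) ω (𝓝 0) := mkAlgHom_eq_iff τ ω

/-- The limit `lim_{k → ω} τ_k(a_k)`. -/
def limTrace (a : boundedSeq A) : ℂ := limUnder (ω : Filter ℕ) (fun k => τ k (a.1 k))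

theorem tendsto_limTrace (a : boundedSeq A) :
    Tendsto (fun k => τ k (a.1 k)) ω (𝓝 (limTrace τ ω a)) := by
  obtain ⟨C, hC⟩ := a.2
  have hK : IsCompact (Metric.closedBall (0 : ℂ) C) := isCompact_closedBall 0 C
  have hle : ((ω.map (fun k => τ k (a.1 k)) : Ultrafilter ℂ) : Filter ℂ) ≤
      𝓟 (Metric.closedBall (0 : ℂ) C) := by
    refine tendsto_principal.2 (Eventually.of_forall fun k => ?_)
    rw [mem_closedBall_zero_iff]
    exact ((τ k).norm_apply_le _).trans (hC k)
  obtain ⟨z, -, hz⟩ := hK.ultrafilter_le_nhds _ hle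
  exact tendsto_nhds_limUnder ⟨z, hz⟩

theorem limTrace_eq {a : boundedSeq A} {z : ℂ} (h : Tendsto (fun k => τ k (a.1 k)) ω (𝓝 z)) :
    limTrace τ ω a = z := tendsto_nhds_unique (tendsto_limTrace τ ω a) h

theorem limTrace_congr {a b : boundedSeq A} (h : mk τ ω a = mk τ ω b) :
    limTrace τ ω a = limTrace τ ω b := by
  rw [mk_eq_iff] at h
  refine limTrace_eq τ ω ?_
  have h0 : Tendsto (fun k => τ k (a.1 k - b.1 k)) ω (𝓝 0) :=
    squeeze_zero_norm (fun k => (τ k).norm_apply_le_twoNorm _) h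
  have h1 := h0.add (tendsto_limTrace τ ω b)
  rw [zero_add] at h1
  exact h1.congr fun k => by rw [map_sub, sub_add_cancel]

/-- The underlying function of the ultraproduct trace, `[a_k] ↦ lim_{k → ω} τ_k(a_k)`. -/
def traceFn : TracialUltraproduct τ ω → ℂ :=
  Quotient.lift (s := Submodule.quotientRel (nullIdeal τ ω)) (limTrace τ ω)
    (fun _ _ h => limTrace_congr τ ω (Quotient.sound h))

theorem traceFn_mk (a : boundedSeq A) : traceFn τ ω (mk τ ω a) = limTrace τ ω a := rfl

/-- The trace `τ_ω([a_k]) = lim_{k → ω} τ_k(a_k)` on the ultraproduct. -/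
def trace : TracialState (TracialUltraproduct τ ω) where
  toFun := traceFn τ ω
  map_add' u v := by
    obtain ⟨a, rfl⟩ := mk_surjective τ ω u
    obtain ⟨b, rfl⟩ := mk_surjective τ ω v
    rw [← map_add, traceFn_mk, traceFn_mk, traceFn_mk]
    refine limTrace_eq τ ω (((tendsto_limTrace τ ω a).add (tendsto_limTrace τ ω b)).congr
      fun k => ?_)
    exact (map_add _ _ _).symm
  map_smul' c u := by
    obtain ⟨a, rfl⟩ := mk_surjective τ ω u
    rw [← map_smul, traceFn_mk, traceFn_mk]
    refine limTrace_eq τ ω (((tendsto_limTrace τ ω a).const_smul c).congr fun k => ?_)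
    exact (map_smul (τ k).toLinearMap c (a.1 k)).symm
  map_one' := by
    rw [← map_one (mk τ ω)]
    change traceFn τ ω (mk τ ω 1) = 1
    rw [traceFn_mk]
    exact limTrace_eq τ ω (tendsto_const_nhds.congr fun k => (τ k).map_one.symm)
  nonneg' u := by
    obtain ⟨a, rfl⟩ := mk_surjective τ ω u
    rw [← map_star, ← map_mul]
    exact ge_of_tendsto' (tendsto_limTrace τ ω _) fun k => (τ k).nonneg (a.1 k)
  tracial' u v := by
    obtain ⟨a, rfl⟩ := mk_surjective τ ω u
    obtain ⟨b, rfl⟩ := mk_surjective τ ω v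
    rw [← map_mul, ← map_mul]
    exact limTrace_eq τ ω ((tendsto_limTrace τ ω (b * a)).congr fun k =>
      (τ k).tracial (b.1 k) (a.1 k))

variable {B : ℕ → Type*} [∀ k, CStarAlgebra (B k)] (σ : ∀ k, TracialState (B k))

/-- The map `[a_k] ↦ [φ_k(a_k)]` of ultraproducts induced by trace-preserving unital
`*`-homomorphisms `φ_k`. -/
def map (φ : ∀ k, A k →⋆ₐ[ℂ] B k) (hφ : ∀ k a, σ k (φ k a) = τ k a) :
    TracialUltraproduct τ ω →⋆ₐ[ℂ] TracialUltraproduct σ ω :=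
  let ψ : boundedSeq A →⋆ₐ[ℂ] boundedSeq B :=
    { toFun := fun a => ⟨fun k => φ k (a.1 k), by
        obtain ⟨C, hC⟩ := a.2
        exact ⟨C, fun k => (NonUnitalStarAlgHom.norm_apply_le (φ k) (a.1 k)).trans (hC k)⟩⟩
      map_one' := Subtype.ext (funext fun k => map_one (φ k))
      map_mul' := fun a b => Subtype.ext (funext fun k => map_mul (φ k) (a.1 k) (b.1 k))
      map_zero' := Subtype.ext (funext fun k => map_zero (φ k))
      map_add' := fun a b => Subtype.ext (funext fun k => map_add (φ k) (a.1 k) (b.1 k))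
      commutes' := fun c => Subtype.ext (funext fun k => AlgHomClass.commutes (φ k) c)
      map_star' := fun a => Subtype.ext (funext fun k => map_star (φ k) (a.1 k)) }
  { Ideal.Quotient.liftₐ (nullIdeal τ ω) ((mk σ ω).toAlgHom.comp ψ.toAlgHom) (by
      intro a ha
      change mk σ ω (ψ a) = 0
      rw [← map_zero (mk σ ω), mk_eq_iff]
      refine ((mem_nullIdeal τ ω).1 ha).congr fun k => ?_
      change _ = (σ k).twoNorm (φ k (a.1 k) - 0)
      rw [sub_zero, TracialState.twoNorm, TracialState.twoNorm, ← map_star, ← map_mul, hφ]) with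
    map_star' := fun u => by
      obtain ⟨a, rfl⟩ := mk_surjective τ ω u
      change mk σ ω (ψ (star a)) = star (mk σ ω (ψ a))
      rw [map_star, map_star] }

theorem map_mk (φ : ∀ k, A k →⋆ₐ[ℂ] B k) (hφ : ∀ k a, σ k (φ k a) = τ k a) (a : ∀ k, A k)
    (ha : a ∈ boundedSeq A) (hb : (fun k => φ k (a k)) ∈ boundedSeq B) :
    map τ ω σ φ hφ (mk τ ω ⟨a, ha⟩) = mk σ ω ⟨fun k => φ k (a k), hb⟩ := rfl

end TracialUltraproduct

end Ultraproduct

/-! ### Conditional expectations and von Neumann algebras -/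

/-- `E : A → B` is the trace-preserving conditional expectation for the inclusion `ι : B → A` of
unital `*`-algebras and the tracial state `τ` on `A`: a linear `B`-bimodule projection onto `B`
that preserves the trace. When `τ` is faithful these conditions determine `E` uniquely, since
`τ (ι (E a) * ι b) = τ (a * ι b)` for all `b`; positivity of `E` follows from them for the
operator algebras considered here. -/
structure IsTracialCondExp {A B : Type*} [Ring A] [StarRing A] [Algebra ℂ A]
    [Ring B] [StarRing B] [Algebra ℂ B] (τ : TracialState A) (ι : B →⋆ₐ[ℂ] A) (E : A →ₗ[ℂ] B) :
    Prop where
  map_incl : ∀ b : B, E (ι b) = b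
  map_bimodule : ∀ (b : B) (a : A) (c : B), E (ι b * a * ι c) = b * E a * c
  trace_preserving : ∀ a : A, τ (ι (E a)) = τ a

section VonNeumann

variable {H : Type*} [NormedAddCommGroup H] [InnerProductSpace ℂ H] [CompleteSpace H]

/-- `τ` is normal, i.e. ultraweakly continuous: it has the form `a ↦ ∑ j, ⟪ξ j, a (η j)⟫` with
`∑ j, ‖ξ j‖ ^ 2 < ∞` and `∑ j, ‖η j‖ ^ 2 < ∞`. -/
def IsNormalState (M : VonNeumannAlgebra H) (τ : TracialState M.toStarSubalgebra) : Prop :=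
  ∃ ξ η : ℕ → H, Summable (fun j => ‖ξ j‖ ^ 2) ∧ Summable (fun j => ‖η j‖ ^ 2) ∧
    ∀ a : M.toStarSubalgebra, HasSum (fun j => inner ℂ (ξ j) ((a : H →L[ℂ] H) (η j))) (τ a)

/-- The elements `x i` of `M` generate `M` as a von Neumann algebra: `M` is the smallest von
Neumann algebra that contains all of them. -/
def GeneratedBy (M : VonNeumannAlgebra H) {I : Type*} (x : I → M.toStarSubalgebra) : Prop :=
  ∀ N : VonNeumannAlgebra H, (∀ i, (x i : H →L[ℂ] H) ∈ N) → M ≤ N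

/-- The inclusion `P → M` of a von Neumann subalgebra. -/
def vnInclusion {P M : VonNeumannAlgebra H} (h : P ≤ M) :
    P.toStarSubalgebra →⋆ₐ[ℂ] M.toStarSubalgebra :=
  StarSubalgebra.inclusion (S₁ := P.toStarSubalgebra) (S₂ := M.toStarSubalgebra) h

end VonNeumann

/-! ### Matrix ultraproducts and random matrix models -/

section Models

/-- The deterministic matrix ultraproduct `∏_{k → ω} M_{n(k)}(ℂ)`. -/
abbrev MatrixUltraproduct (n : ℕ → ℕ) [∀ k, NeZero (n k)] (ω : Ultrafilter ℕ) : Type _ :=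
  TracialUltraproduct (fun k => matrixTrace (n k)) ω

/-- The random matrix ultraproduct `∏_{k → ω} L^∞(Ω, M_{n(k)}(ℂ))`, with respect to the traces
`f ↦ ∫ τ_{n(k)}(f) dμ`. -/
abbrev RandomMatrixUltraproduct (n : ℕ → ℕ) [∀ k, NeZero (n k)] {Ω : Type*} [MeasurableSpace Ω]
    (μ : Measure Ω) [IsProbabilityMeasure μ] (ω : Ultrafilter ℕ) : Type _ :=
  TracialUltraproduct (fun k => Linfty.tracialState μ (matrixTrace (n k))) ω

variable (n : ℕ → ℕ) [∀ k, NeZero (n k)] {Ω : Type*} [MeasurableSpace Ω] (μ : Measure Ω)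
  [IsProbabilityMeasure μ] (ω : Ultrafilter ℕ)

/-- The trace `τ_ω` on the random matrix ultraproduct. -/
def randomTrace : TracialState (RandomMatrixUltraproduct n μ ω) :=
  TracialUltraproduct.trace _ ω

/-- The inclusion `ι_ω` of the deterministic into the random matrix ultraproduct, induced by the
inclusions of `M_{n(k)}(ℂ)` into `L^∞(Ω, M_{n(k)}(ℂ))` as constant functions. -/
def deterministicInclusion : MatrixUltraproduct n ω →⋆ₐ[ℂ] RandomMatrixUltraproduct n μ ω :=
  TracialUltraproduct.map _ ω _ (fun k => Linfty.const μ (Matrix (Fin (n k)) (Fin (n k)) ℂ))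
    (fun k a => Linfty.tracialState_const (matrixTrace (n k)) a)

variable {n μ}
variable {I : Type*} {X : ∀ k, I → Ω → Matrix (Fin (n k)) (Fin (n k)) ℂ}

/-- The element `y i` of the random matrix ultraproduct that is represented by the sequence of
random matrices `(X k i)`, for almost surely uniformly bounded `X`. -/
def modelElement (hX : ∀ k i, AEStronglyMeasurable (X k i) μ) {R : I → ℝ}
    (hb : ∀ k i, ∀ᵐ w ∂μ, ‖X k i w‖ ≤ R i) (i : I) : RandomMatrixUltraproduct n μ ω :=
  TracialUltraproduct.mk _ ω ⟨fun k => Linfty.ofBounded (X k i) (hX k i) ⟨R i, hb k i⟩, |R i|,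
    fun k => Linfty.norm_le (abs_nonneg _) (by
      filter_upwards [hb k i, Linfty.coeFn_ofBounded (X k i) (hX k i) ⟨R i, hb k i⟩] with w h1 h2
      rw [h2]
      exact h1.trans (le_abs_self _))⟩

/-- `ρ : A → ∏_{k → ω} L^∞(Ω, M_{n(k)}(ℂ))` is the trace-preserving embedding with
`ρ (x i) = y i`. -/
structure IsInducedEmbedding {A : Type*} [Ring A] [StarRing A] [Algebra ℂ A] (τ : TracialState A)
    (x : I → A) (y : I → RandomMatrixUltraproduct n μ ω)
    (ρ : A →⋆ₐ[ℂ] RandomMatrixUltraproduct n μ ω) : Prop where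
  trace_preserving : ∀ a : A, randomTrace n μ ω (ρ a) = τ a
  map_generator : ∀ i, ρ (x i) = y i

/-- Convergence of the non-commutative laws of `X k` to that of `x` in probability:
`τ_{n(k)}(p(X k)) → τ(p(x))` in probability for every non-commutative polynomial `p`. -/
def ConvergesInLaw {A : Type*} [Ring A] [StarRing A] [Algebra ℂ A] (τ : TracialState A)
    (x : I → A) (μ : Measure Ω) (X : ∀ k, I → Ω → Matrix (Fin (n k)) (Fin (n k)) ℂ) : Prop :=
  ∀ p : FreeAlgebra ℂ I, TendstoInMeasure μ
    (fun k w => matrixTrace (n k) (FreeAlgebra.lift ℂ (fun i => X k i w) p)) atTop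
    (fun _ => τ (FreeAlgebra.lift ℂ x p))

/-- The external averaging property: `‖𝔼[p(X k)]‖₂ → ‖E[p(x)]‖₂` as `k → ∞` for every
non-commutative polynomial `p`, where `E : A → B` is a conditional expectation for the inclusion
`ι : B → A`. -/
def ExternalAveragingProperty {A B : Type*} [Ring A] [StarRing A] [Algebra ℂ A]
    [Ring B] [StarRing B] [Algebra ℂ B] (τ : TracialState A) (x : I → A) (ι : B →⋆ₐ[ℂ] A)
    (E : A →ₗ[ℂ] B) (μ : Measure Ω) (X : ∀ k, I → Ω → Matrix (Fin (n k)) (Fin (n k)) ℂ) : Prop :=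
  ∀ p : FreeAlgebra ℂ I, Tendsto
    (fun k => (matrixTrace (n k)).twoNorm (∫ w, FreeAlgebra.lift ℂ (fun i => X k i w) p ∂μ))
    atTop (𝓝 (τ.twoNorm (ι (E (FreeAlgebra.lift ℂ x p)))))

end Models

end

/-! Both conditions say the same thing about 2-norms. A trace-preserving conditional expectation is
the orthogonal projection of `L²` onto the closure of the subalgebra. `E_ω` is induced by the matrix
expectations `𝔼` at each `k`, so along a free ultrafilter the norms `‖𝔼[p(X k)]‖₂` converge to `‖E_ω
(ρ_ω (p(x)))‖₂` (`tendsto_twoNorm_integral`). A limit as `k → ∞` is the same as a common limit along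
all free ultrafilters, hence averaging says that `‖E_ω (ρ_ω z)‖₂ = ‖E_P z‖₂` for all `ω` and all
polynomials `z` in `x`; by density and contractivity it then holds for all `z` in `M`.

From (2), this equality is immediate because `ρ_ω` preserves 2-norms. Conversely
(`IsTracialCondExp.intertwine`), for `b` in `P` the projection `E_ω` does not shorten `ρ_ω b`, so it
fixes it; and `z - E_P z` is killed by `E_P`, hence its image is killed by `E_ω`. Together these
give `E_ω ∘ ρ_ω = ρ_ω ∘ E_P` up to inclusions, and the equality of ranges follows.

Existence of the maps rests on two tools. First, truncating by functional calculus does not move a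
self-adjoint approximant away from a self-adjoint target of small norm
(`TracialState.twoNorm_sub_clamp_le`); this plays the role of Kaplansky's density theorem. Second,
norm-bounded 2-norm Cauchy sequences converge (`BallComplete`): in a von Neumann algebra by weak
compactness and normality, in an `ℓ^∞` product with a limit trace by a diagonal argument. `E_P`
comes from truncating approximants of the `L²` projection. `ρ_ω` comes from closing up the graph of
`p(x) ↦ p(X)`, whose first coordinates are 2-norm dense by the bicommutant argument. -/

noncomputable section

/-! ### The pre-Hilbert space of a tracial state -/

namespace TracialState

section Hilbert

variable {A : Type*} [Ring A] [StarRing A] [Algebra ℂ A]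

theorem twoNorm_sq (τ : TracialState A) (a : A) : ((τ.twoNorm a ^ 2 : ℝ) : ℂ) = τ (star a * a) := by
  have h := τ.nonneg a
  rw [twoNorm, Real.sq_sqrt (Complex.le_def.1 h).1]
  exact Complex.ext rfl (Complex.le_def.1 h).2

theorem IsFaithful.eq_of_twoNorm_sub_eq_zero {τ : TracialState A} (hτ : τ.IsFaithful) {a b : A}
    (h : τ.twoNorm (a - b) = 0) : a = b := by
  refine sub_eq_zero.1 (hτ _ ?_)
  rw [← twoNorm_sq, h]
  simp

variable [StarModule ℂ A] (τ : TracialState A)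

/-- Positivity forces Hermitian symmetry: reality of `τ ((1 + c)* (1 + c))` makes `τ c + τ (c*)`
real, and the cases `c = a` and `c = i a` determine `τ (a*)`. -/
theorem map_star (a : A) : τ (star a) = star (τ a) := by
  have key : ∀ c : A, (τ c + τ (star c)).im = 0 := by
    intro c
    have h := (Complex.le_def.1 (τ.nonneg (1 + c))).2
    have h0 := (Complex.le_def.1 (τ.nonneg c)).2
    have e : star (1 + c) * (1 + c) = 1 + (c + star c) + star c * c := by
      rw [star_add, star_one]; noncomm_ring
    rw [e, map_add, map_add, map_add, τ.map_one] at h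
    simp only [Complex.add_im, Complex.one_im, Complex.zero_im] at h h0 ⊢
    linarith
  have h1 := key a
  have h2 := key (Complex.I • a)
  rw [star_smul, map_smul, map_smul] at h2
  simp only [smul_eq_mul, Complex.add_im, Complex.mul_im, Complex.star_def, Complex.conj_I,
    Complex.I_re, Complex.I_im, Complex.neg_re, Complex.neg_im] at h1 h2
  apply Complex.ext
  · simp only [Complex.star_def, Complex.conj_re]; linarith
  · simp only [Complex.star_def, Complex.conj_im]; linarith

/-- The underlying vector space of `A`, seen as a pre-Hilbert space with the inner product
`⟪a, b⟫ = τ (a* b)`. -/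
@[nolint unusedArguments]
def PreL2 (_ : TracialState A) : Type _ := A

instance : AddCommGroup τ.PreL2 := inferInstanceAs (AddCommGroup A)
instance : Module ℂ τ.PreL2 := inferInstanceAs (Module ℂ A)

/-- The identity map from `A` to `PreL2`. -/
def toPreL2 : A →ₗ[ℂ] τ.PreL2 := LinearMap.id (M := A)

/-- The semi-inner product `⟪a, b⟫ = τ (a* b)`. -/
@[reducible]
def preCore : PreInnerProductSpace.Core ℂ τ.PreL2 where
  inner a b := τ (star (show A from a) * (show A from b))
  conj_inner_symm a b := by
    change star (τ (star (show A from b) * (show A from a))) = _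
    rw [← τ.map_star, star_mul, star_star]
  re_inner_nonneg a := (Complex.le_def.1 (τ.nonneg (show A from a))).1
  add_left a b c := by
    change τ (star ((show A from a) + (show A from b)) * (show A from c)) = _
    rw [star_add, add_mul, map_add]
  smul_left a b r := by
    change τ (star (r • (show A from a)) * (show A from b)) = _
    rw [star_smul, smul_mul_assoc, map_smul]
    rfl

/-- Only a seminorm, since faithfulness is not assumed. The completion is Hausdorff, so it
identifies vectors at distance zero. -/
instance : SeminormedAddCommGroup τ.PreL2 :=
  InnerProductSpace.Core.toSeminormedAddCommGroup (c := τ.preCore)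
instance : InnerProductSpace ℂ τ.PreL2 := InnerProductSpace.ofCore τ.preCore

/-- The Hilbert space `L²(A, τ)`. -/
abbrev L2 : Type _ := UniformSpace.Completion τ.PreL2

/-- The canonical map `A → L²(A, τ)`. -/
def toL2 : A →ₗ[ℂ] τ.L2 :=
  (UniformSpace.Completion.toComplₗᵢ (𝕜 := ℂ) (E := τ.PreL2)).toLinearMap ∘ₗ τ.toPreL2

theorem inner_toL2 (a b : A) : inner ℂ (τ.toL2 a) (τ.toL2 b) = τ (star a * b) := by
  change inner ℂ ((τ.toPreL2 a : τ.PreL2) : UniformSpace.Completion τ.PreL2)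
    ((τ.toPreL2 b : τ.PreL2) : UniformSpace.Completion τ.PreL2) = _
  rw [UniformSpace.Completion.inner_coe]
  rfl

theorem norm_toL2 (a : A) : ‖τ.toL2 a‖ = τ.twoNorm a := by
  rw [@norm_eq_sqrt_re_inner ℂ, inner_toL2]
  rfl

theorem norm_apply_star_mul_le (a b : A) : ‖τ (star a * b)‖ ≤ τ.twoNorm a * τ.twoNorm b := by
  rw [← inner_toL2, ← norm_toL2, ← norm_toL2]
  exact norm_inner_le_norm _ _

theorem twoNorm_triangle (a b : A) : τ.twoNorm (a + b) ≤ τ.twoNorm a + τ.twoNorm b := by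
  rw [← norm_toL2, ← norm_toL2, ← norm_toL2, map_add]
  exact norm_add_le _ _

theorem twoNorm_neg (a : A) : τ.twoNorm (-a) = τ.twoNorm a := by
  rw [← norm_toL2, ← norm_toL2, map_neg, norm_neg]

theorem twoNorm_sub_comm (a b : A) : τ.twoNorm (a - b) = τ.twoNorm (b - a) := by
  rw [← neg_sub, twoNorm_neg]

theorem twoNorm_zero : τ.twoNorm 0 = 0 := by
  rw [← norm_toL2, map_zero, norm_zero]

theorem twoNorm_sub_triangle (a b c : A) :
    τ.twoNorm (a - c) ≤ τ.twoNorm (a - b) + τ.twoNorm (b - c) := by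
  simpa using τ.twoNorm_triangle (a - b) (b - c)

theorem twoNorm_smul (c : ℂ) (a : A) : τ.twoNorm (c • a) = ‖c‖ * τ.twoNorm a := by
  rw [← norm_toL2, ← norm_toL2, map_smul, norm_smul]

theorem abs_twoNorm_sub_le (a b : A) : |τ.twoNorm a - τ.twoNorm b| ≤ τ.twoNorm (a - b) := by
  rw [← norm_toL2, ← norm_toL2, ← norm_toL2, map_sub]
  exact abs_norm_sub_norm_le _ _

theorem twoNorm_sub_sq {a b : A} (h : τ (star b * (a - b)) = 0) :
    τ.twoNorm a ^ 2 = τ.twoNorm b ^ 2 + τ.twoNorm (a - b) ^ 2 := by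
  rw [← norm_toL2, ← norm_toL2, ← norm_toL2, sq, sq, sq,
    ← norm_add_sq_eq_norm_sq_add_norm_sq_of_inner_eq_zero (𝕜 := ℂ) _ _ (by rw [inner_toL2, h]),
    ← map_add, add_sub_cancel]

end Hilbert

end TracialState

/-! ### Conditional expectations as orthogonal projections -/

namespace IsTracialCondExp

variable {A B : Type*} [Ring A] [StarRing A] [Algebra ℂ A]
  [Ring B] [StarRing B] [Algebra ℂ B] {τ : TracialState A} {ι : B →⋆ₐ[ℂ] A} {E : A →ₗ[ℂ] B}

theorem map_incl_mul (hE : IsTracialCondExp τ ι E) (b : B) (a : A) : E (ι b * a) = b * E a := by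
  simpa using hE.map_bimodule b a 1

theorem trace_mul (hE : IsTracialCondExp τ ι E) (b : B) (a : A) :
    τ (ι b * ι (E a)) = τ (ι b * a) := by
  rw [← hE.trace_preserving (ι b * a), hE.map_incl_mul, map_mul ι]

/-- Bimodularity and trace preservation combine into orthogonality of `a - ι (E a)` to the range of
`ι`. Uniqueness, Pythagoras and 2-norm contractivity all come from this relation. -/
theorem trace_star_mul_sub (hE : IsTracialCondExp τ ι E) (b : B) (a : A) :
    τ (star (ι b) * (a - ι (E a))) = 0 := by
  rw [← map_star ι, mul_sub, map_sub, hE.trace_mul, sub_self]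

theorem unique (hτ : τ.IsFaithful) (hι : Function.Injective ι) {E' : A →ₗ[ℂ] B}
    (hE : IsTracialCondExp τ ι E) (hE' : IsTracialCondExp τ ι E') : E = E' := by
  ext a
  refine hι (sub_eq_zero.1 (hτ _ ?_))
  have h1 := hE.trace_star_mul_sub (E a - E' a) a
  have h2 := hE'.trace_star_mul_sub (E a - E' a) a
  rw [map_sub] at h1 h2
  have : ι (E a) - ι (E' a) = (a - ι (E' a)) - (a - ι (E a)) := by abel
  rw [show star (ι (E a) - ι (E' a)) * (ι (E a) - ι (E' a)) = star (ι (E a) - ι (E' a)) *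
    (a - ι (E' a)) - star (ι (E a) - ι (E' a)) * (a - ι (E a)) by rw [← mul_sub, ← this],
    map_sub, h1, h2, sub_zero]

variable [StarModule ℂ A]

theorem pythagoras (hE : IsTracialCondExp τ ι E) (a : A) :
    τ.twoNorm a ^ 2 = τ.twoNorm (ι (E a)) ^ 2 + τ.twoNorm (a - ι (E a)) ^ 2 :=
  τ.twoNorm_sub_sq (hE.trace_star_mul_sub _ _)

theorem twoNorm_le (hE : IsTracialCondExp τ ι E) (a : A) : τ.twoNorm (ι (E a)) ≤ τ.twoNorm a := by
  refine le_of_sq_le_sq ?_ (τ.twoNorm_nonneg a)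
  have := hE.pythagoras a
  nlinarith [sq_nonneg (τ.twoNorm (a - ι (E a)))]

end IsTracialCondExp

/-- If `F` and `E` are conditional expectations for `j` and `ι`, and the trace-preserving
homomorphism `ρ` satisfies `‖F (ρ z)‖₂ = ‖E z‖₂`, then `ρ` intertwines `F` and `E`, and the range of
`ι` corresponds to the elements of the range of `ρ` that lie in the range of `j`. -/
theorem IsTracialCondExp.intertwine {A B U D : Type*} [Ring A] [StarRing A] [Algebra ℂ A]
    [StarModule ℂ A] [Ring B] [StarRing B] [Algebra ℂ B]
    [Ring U] [StarRing U] [Algebra ℂ U] [StarModule ℂ U] [Ring D] [StarRing D] [Algebra ℂ D]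
    {τ : TracialState A} {ι : B →⋆ₐ[ℂ] A} {E : A →ₗ[ℂ] B} (hE : IsTracialCondExp τ ι E)
    {σ : TracialState U} (hσ : σ.IsFaithful) {j : D →⋆ₐ[ℂ] U} {F : U →ₗ[ℂ] D}
    (hF : IsTracialCondExp σ j F) {ρ : A →⋆ₐ[ℂ] U} (hρ : ∀ a, σ (ρ a) = τ a)
    (h : ∀ z, σ.twoNorm (j (F (ρ z))) = τ.twoNorm (ι (E z))) :
    ρ '' Set.range ι = Set.range ρ ∩ Set.range j ∧ ∀ z, j (F (ρ z)) = ρ (ι (E z)) := by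
  have hρ2 : ∀ a, σ.twoNorm (ρ a) = τ.twoNorm a := fun a => by
    rw [TracialState.twoNorm, TracialState.twoNorm, ← map_star, ← map_mul, hρ]
  -- The projection has the same 2-norm as the vector itself, so Pythagoras leaves no orthogonal
  -- part.
  have h1 : ∀ b, j (F (ρ (ι b))) = ρ (ι b) := fun b => by
    refine (hσ.eq_of_twoNorm_sub_eq_zero ?_).symm
    have hp := hF.pythagoras (ρ (ι b))
    rw [h, hE.map_incl, hρ2] at hp
    exact pow_eq_zero_iff two_ne_zero |>.1 (by linarith)
  have h2 : ∀ z, j (F (ρ z)) = ρ (ι (E z)) := fun z => by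
    -- `E` kills `z - ι (E z)`, so the equality of 2-norms makes `F ∘ ρ` kill it too.
    have h3 : j (F (ρ (z - ι (E z)))) = 0 := by
      refine hσ.eq_of_twoNorm_sub_eq_zero ?_
      rw [sub_zero, h, map_sub, hE.map_incl, sub_self, map_zero, TracialState.twoNorm_zero]
    rw [map_sub, map_sub, map_sub, h1] at h3
    exact sub_eq_zero.1 h3
  refine ⟨Set.Subset.antisymm ?_ ?_, h2⟩
  · rintro _ ⟨_, ⟨b, rfl⟩, rfl⟩
    exact ⟨⟨_, rfl⟩, ⟨_, h1 b⟩⟩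
  · rintro _ ⟨⟨z, rfl⟩, ⟨d, hd⟩⟩
    refine ⟨_, ⟨E z, rfl⟩, ?_⟩
    rw [← h2, ← hd, hF.map_incl]

/-! ### Truncation by functional calculus -/

/-- The truncation of the real line to `[-C, C]`. -/
def clampFun (C t : ℝ) : ℝ := max (-C) (min t C)

theorem continuous_clampFun (C : ℝ) : Continuous (clampFun C) := by
  unfold clampFun; fun_prop

theorem abs_clampFun_le {C : ℝ} (hC : 0 ≤ C) (t : ℝ) : |clampFun C t| ≤ C :=
  abs_le.2 ⟨le_max_left _ _, max_le (by linarith) (min_le_right _ _)⟩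

section Clamp

variable {A : Type*} [CStarAlgebra A]

theorem norm_cfc_clampFun_le {C : ℝ} (hC : 0 ≤ C) (b : A) : ‖cfc (clampFun C) b‖ ≤ C :=
  norm_cfc_le hC fun t _ => abs_clampFun_le hC t

/-- Truncation at level `C` does not increase the distance in `2`-norm to a self-adjoint element of
norm at most `C`. -/
theorem TracialState.twoNorm_sub_clamp_le (τ : TracialState A) {a b : A} (ha : IsSelfAdjoint a)
    (hb : IsSelfAdjoint b) {C : ℝ} (hC : ‖a‖ ≤ C) :
    τ.twoNorm (a - cfc (clampFun C) b) ≤ τ.twoNorm (a - b) := by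
  let _ := CStarAlgebra.spectralOrder A
  have _ := CStarAlgebra.spectralOrderedRing A
  have hpos : ∀ d s : A, 0 ≤ d → IsSelfAdjoint s → 0 ≤ (τ (d * (s * s))).re := by
    intro d s hd hs
    have h : 0 ≤ s * d * s := by simpa [hs.star_eq] using star_left_conjugate_nonneg hd s
    obtain ⟨c, hc⟩ := (CStarAlgebra.nonneg_iff_eq_star_mul_self).1 h
    have h2 := τ.nonneg c
    rw [← hc, mul_assoc, τ.tracial, mul_assoc] at h2
    exact (Complex.le_def.1 h2).1
  have hle : a ≤ algebraMap ℝ A C ∧ -algebraMap ℝ A C ≤ a := by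
    have h1 := IsSelfAdjoint.le_algebraMap_norm_self ha
    have h2 := IsSelfAdjoint.neg_algebraMap_norm_le_self ha
    have h3 : algebraMap ℝ A ‖a‖ ≤ algebraMap ℝ A C := by
      rw [← sub_nonneg, ← map_sub]
      exact (algebraMap_nonneg A (sub_nonneg.2 hC) :)
    exact ⟨h1.trans h3, (neg_le_neg h3).trans h2⟩
  -- `p²` and `q²` are the overshoots of `t` above `C` and below `-C`. The clamp equals `C` where `p
  -- ≠ 0` and `-C` where `q ≠ 0`, which gives `e1` and `e2`.
  set p := fun t : ℝ => √(max (t - C) 0) with hp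
  set q := fun t : ℝ => √(max (-C - t) 0) with hq
  set c := cfc (clampFun C) b with hc
  have hpc : Continuous p := by fun_prop
  have hqc : Continuous q := by fun_prop
  have hcc := continuous_clampFun C
  have hC0 : 0 ≤ C := (norm_nonneg a).trans hC
  have e1 : ∀ t : ℝ, t - clampFun C t = p t * p t - q t * q t := by
    intro t
    simp only [hp, hq]
    rw [Real.mul_self_sqrt (le_max_right _ _), Real.mul_self_sqrt (le_max_right _ _), clampFun]
    rcases le_total t C with h1 | h1
    · rcases le_total (-C) t with h2 | h2
      · rw [min_eq_left h1, max_eq_right h2, max_eq_right (by linarith), max_eq_right (by linarith)]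
        ring
      · rw [min_eq_left h1, max_eq_left h2, max_eq_right (by linarith), max_eq_left (by linarith)]
        ring
    · rw [min_eq_right h1, max_eq_right (by linarith), max_eq_left (by linarith),
        max_eq_right (by linarith)]
      ring
  have e2 : ∀ t : ℝ, (clampFun C t) * (t - clampFun C t) = C * (p t * p t) + C * (q t * q t) := by
    intro t
    simp only [hp, hq]
    rw [Real.mul_self_sqrt (le_max_right _ _), Real.mul_self_sqrt (le_max_right _ _), clampFun]
    rcases le_total t C with h1 | h1
    · rcases le_total (-C) t with h2 | h2
      · rw [min_eq_left h1, max_eq_right h2, max_eq_right (by linarith), max_eq_right (by linarith)]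
        ring
      · rw [min_eq_left h1, max_eq_left h2, max_eq_right (by linarith), max_eq_left (by linarith)]
        ring
    · rw [min_eq_right h1, max_eq_right (by linarith), max_eq_left (by linarith),
        max_eq_right (by linarith)]
      ring
  set P := cfc p b with hP
  set Q := cfc q b with hQ
  have hPs : IsSelfAdjoint P := cfc_predicate p b
  have hQs : IsSelfAdjoint Q := cfc_predicate q b
  have hcs : IsSelfAdjoint c := cfc_predicate (clampFun C) b
  have E0 : b - c = cfc (fun t => t - clampFun C t) b := by
    rw [cfc_sub (fun t => t) (clampFun C) b, cfc_id' ℝ b]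
  have E1 : b - c = P * P - Q * Q := by
    rw [hP, hQ, ← cfc_mul p p b, ← cfc_mul q q b, ← cfc_sub (fun t => p t * p t)
      (fun t => q t * q t) b]
    rw [E0]
    exact cfc_congr fun t _ => e1 t
  have E2 : c * (b - c) = C • (P * P) + C • (Q * Q) := by
    rw [hP, hQ, ← cfc_mul p p b, ← cfc_mul q q b, ← cfc_smul C (fun t => p t * p t) b,
      ← cfc_smul C (fun t => q t * q t) b, ← cfc_add (a := b) (fun t => C • (p t * p t))
      (fun t => C • (q t * q t))]
    rw [E0, hc, ← cfc_mul (clampFun C) (fun t => t - clampFun C t) b]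
    exact cfc_congr fun t _ => e2 t
  -- The variational inequality for the nearest point of a convex set: since `-C ≤ a ≤ C`, both
  -- summands have trace of nonnegative real part, so `a - c` and `c - b` form no obtuse angle and
  -- `‖a - b‖₂ ≥ ‖a - c‖₂`.
  have E3 : (a - c) * (c - b) = (algebraMap ℝ A C - a) * (P * P)
      + (a - -algebraMap ℝ A C) * (Q * Q) := by
    rw [← neg_sub b c, mul_neg, sub_mul, E2, E1]
    simp only [Algebra.algebraMap_eq_smul_one, sub_mul, mul_sub, smul_mul_assoc, one_mul,
      sub_neg_eq_add, add_mul]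
    abel
  have hcross : 0 ≤ (τ ((a - c) * (c - b))).re := by
    rw [E3, map_add, Complex.add_re]
    exact add_nonneg (hpos _ _ (sub_nonneg.2 hle.1) hPs) (hpos _ _ (sub_nonneg.2 hle.2) hQs)
  rw [← norm_toL2, ← norm_toL2]
  refine le_of_sq_le_sq ?_ (norm_nonneg _)
  rw [show a - b = (a - c) + (c - b) by abel, map_add, @norm_add_sq ℂ, inner_toL2,
    (ha.sub hcs).star_eq]
  have := sq_nonneg ‖τ.toL2 (c - b)‖
  have h2 : (0 : ℝ) ≤ 2 * RCLike.re (τ ((a - c) * (c - b))) := mul_nonneg zero_le_two hcross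
  linarith

end Clamp

/-! ### Complete balls and conditional expectations -/

namespace TracialState

variable {A : Type*} [CStarAlgebra A]

/-- Norm-bounded sequences in `S` that are Cauchy in `2`-norm converge in `2`-norm in `S`. -/
def BallComplete (τ : TracialState A) (S : Set A) : Prop :=
  ∀ (u : ℕ → A) (C : ℝ), (∀ j, u j ∈ S) → (∀ j, ‖u j‖ ≤ C) → CauchySeq (fun j => τ.toL2 (u j)) →
    ∃ v ∈ S, Tendsto (fun j => τ.twoNorm (u j - v)) atTop (𝓝 0)

variable {τ : TracialState A}

theorem tendsto_toL2_iff {α : Type*} {l : Filter α} {u : α → A} {v : A} :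
    Tendsto (fun j => τ.toL2 (u j)) l (𝓝 (τ.toL2 v)) ↔
      Tendsto (fun j => τ.twoNorm (u j - v)) l (𝓝 0) := by
  rw [tendsto_iff_norm_sub_tendsto_zero]
  simp_rw [← map_sub, norm_toL2]

/-- Passing to the self-adjoint part does not increase the `2`-norm distance to a self-adjoint
element. -/
theorem exists_isSelfAdjoint_twoNorm_sub_le (τ : TracialState A) {a : A} (ha : IsSelfAdjoint a)
    (b : A) : ∃ c : A, c = (2⁻¹ : ℂ) • (b + star b) ∧ IsSelfAdjoint c ∧
      τ.twoNorm (a - c) ≤ τ.twoNorm (a - b) := by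
  refine ⟨_, rfl, ?_, ?_⟩
  · rw [IsSelfAdjoint, star_smul, star_add, star_star, add_comm (star b)]
    simp
  · have e : a - (2⁻¹ : ℂ) • (b + star b) = (2⁻¹ : ℂ) • ((a - b) + star (a - b)) := by
      rw [star_sub, ha.star_eq]
      have : a = (2⁻¹ : ℂ) • (a + a) := by rw [← two_smul ℂ a, smul_smul]; norm_num
      nth_rw 1 [this]
      rw [← smul_sub]
      congr 1
      abel
    rw [e, twoNorm_smul]
    have h := τ.twoNorm_add_le (a - b) (star (a - b))
    rw [twoNorm_star] at h
    rw [show ‖(2⁻¹ : ℂ)‖ = 2⁻¹ by norm_num]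
    linarith

/-- A self-adjoint element has an orthogonal projection onto a closed `*`-subalgebra with
complete balls. -/
theorem exists_orthogonal_of_isSelfAdjoint (B : StarSubalgebra ℂ A)
    (hclosed : IsClosed (B : Set A)) (hB : τ.BallComplete B) {a : A} (ha : IsSelfAdjoint a) :
    ∃ b ∈ B, ∀ c ∈ B, τ (star c * (a - b)) = 0 := by
  set K : Submodule ℂ τ.L2 :=
    (B.toSubalgebra.toSubmodule.map τ.toL2).topologicalClosure with hK
  have : CompleteSpace K := (Submodule.isClosed_topologicalClosure _).completeSpace_coe
  set ξ : τ.L2 := K.starProjection (τ.toL2 a) with hξ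
  have hξK : ξ ∈ K := Submodule.starProjection_apply_mem _ _
  have hmem : ∀ b ∈ B, τ.toL2 b ∈ K := fun b hb =>
    Submodule.le_topologicalClosure _ (Submodule.mem_map_of_mem hb)
  -- Among elements of `B`, being closer to `a` is the same as being closer to `ξ`. Symmetrizing and
  -- truncating an approximant do not increase its distance to `a`, hence preserve convergence to
  -- `ξ` while providing the norm bound `‖a‖`.
  have hpyth : ∀ b ∈ B, ‖τ.toL2 (a - b)‖ ^ 2 = ‖τ.toL2 a - ξ‖ ^ 2 + ‖ξ - τ.toL2 b‖ ^ 2 := by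
    intro b hb
    have h0 : inner ℂ (τ.toL2 a - ξ) (ξ - τ.toL2 b) = 0 :=
      (Submodule.mem_orthogonal' _ _).1 (Submodule.sub_starProjection_mem_orthogonal (K := K) _) _
        (K.sub_mem hξK (hmem b hb))
    rw [map_sub, sq, sq, sq, ← norm_add_sq_eq_norm_sq_add_norm_sq_of_inner_eq_zero _ _ h0,
      sub_add_sub_cancel]
  obtain ⟨y, hy, hylim⟩ := mem_closure_iff_seq_limit.1
    (show ξ ∈ closure ((B.toSubalgebra.toSubmodule.map τ.toL2 : Submodule ℂ τ.L2) : Set τ.L2)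
      from hξK)
  choose b hbB hby using hy
  choose c hc hcs hcle using fun j => τ.exists_isSelfAdjoint_twoNorm_sub_le ha (b j)
  have hcB : ∀ j, c j ∈ B := fun j => by
    rw [hc]
    exact B.smul_mem (add_mem (hbB j) (star_mem (hbB j))) _
  set d : ℕ → A := fun j => cfc (clampFun ‖a‖) (c j) with hd
  have hdB : ∀ j, d j ∈ B := fun j =>
    cfc_mem (hs := hclosed) (𝕜' := ℂ) (clampFun ‖a‖) (hcB j)
  have hdist : ∀ j, ‖ξ - τ.toL2 (d j)‖ ≤ ‖ξ - y j‖ := by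
    intro j
    have h1 : ‖τ.toL2 (a - d j)‖ ≤ ‖τ.toL2 (a - b j)‖ := by
      rw [norm_toL2, norm_toL2]
      exact (τ.twoNorm_sub_clamp_le ha (hcs j) le_rfl).trans (hcle j)
    have h2 := hpyth _ (hdB j)
    have h3 := hpyth _ (hbB j)
    have h4 := pow_le_pow_left₀ (norm_nonneg _) h1 2
    rw [← hby j]
    exact le_of_sq_le_sq (by linarith) (norm_nonneg _)
  have hdlim : Tendsto (fun j => τ.toL2 (d j)) atTop (𝓝 ξ) := by
    rw [tendsto_iff_norm_sub_tendsto_zero] at hylim ⊢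
    refine squeeze_zero (fun _ => norm_nonneg _) (fun j => ?_) hylim
    rw [norm_sub_rev, norm_sub_rev (y j)]
    exact hdist j
  obtain ⟨v, hvB, hv⟩ := hB d ‖a‖ hdB (fun j => norm_cfc_clampFun_le (norm_nonneg a) _)
    hdlim.cauchySeq
  have hvξ : τ.toL2 v = ξ := tendsto_nhds_unique (tendsto_toL2_iff.2 hv) hdlim
  refine ⟨v, hvB, fun x hx => ?_⟩
  rw [← inner_toL2, map_sub, hvξ]
  exact (Submodule.mem_orthogonal _ _).1 (Submodule.sub_starProjection_mem_orthogonal (K := K) _)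
    _ (hmem x hx)

theorem exists_orthogonal (B : StarSubalgebra ℂ A) (hclosed : IsClosed (B : Set A))
    (hB : τ.BallComplete B) (a : A) : ∃ b ∈ B, ∀ c ∈ B, τ (star c * (a - b)) = 0 := by
  obtain ⟨b, hb, hb'⟩ := exists_orthogonal_of_isSelfAdjoint B hclosed hB (realPart a).2
  obtain ⟨c, hc, hc'⟩ := exists_orthogonal_of_isSelfAdjoint B hclosed hB (imaginaryPart a).2
  refine ⟨b + Complex.I • c, B.add_mem hb (B.smul_mem hc _), fun d hd => ?_⟩
  have e : a - (b + Complex.I • c) = ((realPart a : A) - b) +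
      Complex.I • ((imaginaryPart a : A) - c) := by
    nth_rw 1 [← realPart_add_I_smul_imaginaryPart a]
    rw [smul_sub]
    abel
  rw [e, mul_add, map_add, mul_smul_comm, map_smul, hb' d hd, hc' d hd]
  simp

end TracialState

/-- A conditional expectation exists as soon as orthogonal projections exist. -/
theorem IsTracialCondExp.exists_of_orthogonal {A B : Type*} [Ring A] [StarRing A] [Algebra ℂ A]
    [Ring B] [StarRing B] [Algebra ℂ B] {τ : TracialState A}
    (hτ : τ.IsFaithful) {ι : B →⋆ₐ[ℂ] A} (hι : Function.Injective ι)
    (h : ∀ a, ∃ b : B, ∀ c : B, τ (star (ι c) * (a - ι b)) = 0) :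
    ∃ E : A →ₗ[ℂ] B, IsTracialCondExp τ ι E := by
  choose e he using h
  -- Faithfulness makes the projection unique, so linearity, the projection property and
  -- bimodularity each reduce to an orthogonality relation.
  have huniq : ∀ a b, (∀ c : B, τ (star (ι c) * (a - ι b)) = 0) → e a = b := by
    intro a b hb
    refine hι (sub_eq_zero.1 (hτ _ ?_))
    have h1 := he a (e a - b)
    have h2 := hb (e a - b)
    rw [map_sub] at h1 h2
    have e1 : ι (e a) - ι b = (a - ι b) - (a - ι (e a)) := by abel
    nth_rw 2 [e1]
    rw [mul_sub, map_sub, h1, h2, sub_zero]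
  refine ⟨{ toFun := e, map_add' := fun a b => huniq _ _ fun c => ?_,
            map_smul' := fun r a => huniq _ _ fun c => ?_ }, ⟨fun b => ?_, fun b a c => ?_, fun a => ?_⟩⟩
  · rw [map_add, add_sub_add_comm, mul_add, map_add, he, he, add_zero]
  · rw [RingHom.id_apply, map_smul, ← smul_sub, mul_smul_comm, map_smul, he, smul_zero]
  · exact huniq _ _ fun c => by rw [sub_self, mul_zero, map_zero]
  · refine huniq _ _ fun d => ?_
    rw [map_mul ι, map_mul ι, ← sub_mul, ← mul_sub, ← mul_assoc, τ.tracial, ← mul_assoc, ← mul_assoc]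
    -- By cyclicity of the trace the right factor `c` moves to the front, so the test vector `d`
    -- becomes `b* d c*`.
    have := he a (star b * d * star c)
    rwa [map_mul ι, map_mul ι, star_mul, star_mul, StarHomClass.map_star ι, StarHomClass.map_star ι, star_star, star_star,
      ← mul_assoc] at this
  · have := he a 1
    rw [map_one, star_one, one_mul, map_sub, sub_eq_zero] at this
    exact this.symm

/-! ### Extension of trace-preserving homomorphisms -/

namespace TracialState

variable {A : Type*} [CStarAlgebra A]

/-- Products are in general 2-norm continuous only on norm-bounded sets: one error term costs the
operator norm of `g j`, the other that of the limit `b`. This is why graph closures use bounded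
sequences. -/
theorem tendsto_twoNorm_mul (τ : TracialState A) {g h : ℕ → A} {a b : A} {C : ℝ}
    (hg : ∀ j, ‖g j‖ ≤ C)
    (h1 : Tendsto (fun j => τ.twoNorm (g j - a)) atTop (𝓝 0))
    (h2 : Tendsto (fun j => τ.twoNorm (h j - b)) atTop (𝓝 0)) :
    Tendsto (fun j => τ.twoNorm (g j * h j - a * b)) atTop (𝓝 0) := by
  have h3 : Tendsto (fun j => C * τ.twoNorm (h j - b) + τ.twoNorm (g j - a) * ‖b‖) atTop (𝓝 0) := by
    simpa using (h2.const_mul C).add (h1.mul_const ‖b‖)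
  refine squeeze_zero (fun _ => τ.twoNorm_nonneg _) (fun j => ?_) h3
  have e : g j * h j - a * b = g j * (h j - b) + (g j - a) * b := by noncomm_ring
  rw [e]
  exact (τ.twoNorm_add_le _ _).trans (add_le_add ((τ.twoNorm_mul_le _ _).trans
    (mul_le_mul_of_nonneg_right (hg j) (τ.twoNorm_nonneg _))) (τ.twoNorm_mul_le' _ _))

theorem tendsto_twoNorm_add (τ : TracialState A) {g h : ℕ → A} {a b : A}
    (h1 : Tendsto (fun j => τ.twoNorm (g j - a)) atTop (𝓝 0))
    (h2 : Tendsto (fun j => τ.twoNorm (h j - b)) atTop (𝓝 0)) :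
    Tendsto (fun j => τ.twoNorm (g j + h j - (a + b))) atTop (𝓝 0) := by
  rw [← tendsto_toL2_iff] at *
  simpa using h1.add h2

theorem tendsto_twoNorm_star (τ : TracialState A) {g : ℕ → A} {a : A}
    (h1 : Tendsto (fun j => τ.twoNorm (g j - a)) atTop (𝓝 0)) :
    Tendsto (fun j => τ.twoNorm (star (g j) - star a)) atTop (𝓝 0) := by
  refine h1.congr fun j => ?_
  rw [← star_sub, twoNorm_star]

theorem tendsto_apply_of_twoNorm (τ : TracialState A) {α : Type*} {l : Filter α} {g : α → A} {a : A}
    (h1 : Tendsto (fun j => τ.twoNorm (g j - a)) l (𝓝 0)) :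
    Tendsto (fun j => τ (g j)) l (𝓝 (τ a)) := by
  rw [tendsto_iff_norm_sub_tendsto_zero]
  refine squeeze_zero (fun _ => norm_nonneg _) (fun j => ?_) h1
  rw [← map_sub]
  exact τ.norm_apply_le_twoNorm _

variable {N : Type*} [CStarAlgebra N]

/-- Functional calculus stays inside closed `*`-subalgebras and commutes with homomorphisms. For a
graph in `A × N` and `φ` the first projection, it bounds both coordinates at once while truncating
the first. -/
theorem exists_clamp {X : Type*} [CStarAlgebra X] {G : StarSubalgebra ℂ X}
    (hG : IsClosed (G : Set X)) {h : X} (hh : h ∈ G) (hs : IsSelfAdjoint h) {C : ℝ} (hC : 0 ≤ C)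
    (φ : X →⋆ₐ[ℂ] A) : ∃ k ∈ G, ‖k‖ ≤ C ∧ φ k = cfc (clampFun C) (φ h) := by
  refine ⟨cfc (clampFun C) h, cfc_mem (hs := hG) (𝕜' := ℂ) (clampFun C) hh,
    norm_cfc_clampFun_le hC h, ?_⟩
  exact StarAlgHomClass.map_cfc (S := ℂ) φ (clampFun C) h
    (hf := (continuous_clampFun C).continuousOn)
    (hφ := (NonUnitalStarAlgHom.instContinuousLinearMapClassComplex (F := X →⋆ₐ[ℂ] A)
      ).map_continuous φ) (ha := hs) (hφa := hs.map φ)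

/-- The pairs that are `2`-norm limits of norm-bounded sequences in `G`. -/
def GraphClosure (τ : TracialState A) (σ : TracialState N) (G : StarSubalgebra ℂ (A × N))
    (a : A) (u : N) : Prop :=
  ∃ (g : ℕ → A × N) (C : ℝ), (∀ j, g j ∈ G) ∧ (∀ j, ‖g j‖ ≤ C) ∧
    Tendsto (fun j => τ.twoNorm ((g j).1 - a)) atTop (𝓝 0) ∧
    Tendsto (fun j => σ.twoNorm ((g j).2 - u)) atTop (𝓝 0)

namespace GraphClosure

variable {τ : TracialState A} {σ : TracialState N} {G : StarSubalgebra ℂ (A × N)} {a b : A}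
  {u v : N}

theorem of_mem {g : A × N} (hg : g ∈ G) : GraphClosure τ σ G g.1 g.2 :=
  ⟨fun _ => g, ‖g‖, fun _ => hg, fun _ => le_rfl, by simp [twoNorm_zero], by simp [twoNorm_zero]⟩

theorem add (h : GraphClosure τ σ G a u) (h' : GraphClosure τ σ G b v) :
    GraphClosure τ σ G (a + b) (u + v) := by
  obtain ⟨g, C, h1, h2, h3, h4⟩ := h
  obtain ⟨g', C', h1', h2', h3', h4'⟩ := h'
  exact ⟨fun j => g j + g' j, C + C', fun j => G.add_mem (h1 j) (h1' j),
    fun j => (norm_add_le _ _).trans (add_le_add (h2 j) (h2' j)), τ.tendsto_twoNorm_add h3 h3',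
    σ.tendsto_twoNorm_add h4 h4'⟩

theorem mul (h : GraphClosure τ σ G a u) (h' : GraphClosure τ σ G b v) :
    GraphClosure τ σ G (a * b) (u * v) := by
  obtain ⟨g, C, h1, h2, h3, h4⟩ := h
  obtain ⟨g', C', h1', h2', h3', h4'⟩ := h'
  exact ⟨fun j => g j * g' j, C * C', fun j => G.mul_mem (h1 j) (h1' j),
    fun j => (norm_mul_le _ _).trans
      (mul_le_mul (h2 j) (h2' j) (norm_nonneg _) ((norm_nonneg _).trans (h2 j))),
    τ.tendsto_twoNorm_mul (fun j => (norm_fst_le (g j)).trans (h2 j)) h3 h3',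
    σ.tendsto_twoNorm_mul (fun j => (norm_snd_le (g j)).trans (h2 j)) h4 h4'⟩

theorem star (h : GraphClosure τ σ G a u) : GraphClosure τ σ G (star a) (star u) := by
  obtain ⟨g, C, h1, h2, h3, h4⟩ := h
  exact ⟨fun j => Star.star (g j), C, fun j => star_mem (h1 j),
    fun j => (norm_star _).le.trans (h2 j), τ.tendsto_twoNorm_star h3, σ.tendsto_twoNorm_star h4⟩

theorem scalar (c : ℂ) : GraphClosure τ σ G (algebraMap ℂ A c) (algebraMap ℂ N c) :=
  of_mem (g := algebraMap ℂ (A × N) c) (algebraMap_mem G c)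

theorem sub (h : GraphClosure τ σ G a u) (h' : GraphClosure τ σ G b v) :
    GraphClosure τ σ G (a - b) (u - v) := by
  simpa [sub_eq_add_neg] using h.add ((scalar (-1)).mul h')

theorem apply_eq (htr : ∀ g ∈ G, σ g.2 = τ g.1) (h : GraphClosure τ σ G a u) : σ u = τ a := by
  obtain ⟨g, C, h1, h2, h3, h4⟩ := h
  exact tendsto_nhds_unique (σ.tendsto_apply_of_twoNorm h4)
    ((τ.tendsto_apply_of_twoNorm h3).congr fun j => (htr _ (h1 j)).symm)

/-- Approximants of `a` taken from the graph are symmetrized and truncated at `‖a‖`. The first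
coordinates still converge to `a`; the second ones are Cauchy because trace preservation equates the
2-norms of differences in the two coordinates. -/
theorem exists_of_isSelfAdjoint (hσ : σ.BallComplete Set.univ)
    (hG : IsClosed (G : Set (A × N))) (htr : ∀ g ∈ G, σ g.2 = τ g.1)
    (hdense : ∀ a, ∀ ε > 0, ∃ g ∈ G, τ.twoNorm (a - g.1) < ε) (ha : IsSelfAdjoint a) :
    ∃ u, GraphClosure τ σ G a u := by
  choose g hg hga using fun j : ℕ => hdense a (1 / ((j : ℝ) + 1)) (by positivity)
  set h : ℕ → A × N := fun j => (2⁻¹ : ℂ) • (g j + Star.star (g j)) with hh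
  have hG' : ∀ j, h j ∈ G := fun j =>
    G.smul_mem (add_mem (hg j) (star_mem (hg j))) _
  have hs : ∀ j, IsSelfAdjoint (h j) := fun j => by
    rw [IsSelfAdjoint, hh, star_smul, star_add, star_star, add_comm (Star.star (g j))]
    simp
  have hs1 : ∀ j, IsSelfAdjoint (h j).1 := fun j => congrArg Prod.fst (hs j)
  have hs2 : ∀ j, IsSelfAdjoint (h j).2 := fun j => congrArg Prod.snd (hs j)
  have hha : ∀ j, τ.twoNorm (a - (h j).1) ≤ 1 / ((j : ℝ) + 1) := fun j => by
    obtain ⟨c, hc, -, hc'⟩ := τ.exists_isSelfAdjoint_twoNorm_sub_le ha (g j).1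
    exact (hc ▸ hc').trans (hga j).le
  choose k hkG hkn hk1 using fun j =>
    exists_clamp hG (hG' j) (hs j) (norm_nonneg a) (StarAlgHom.fst ℂ A N)
  have hlim : Tendsto (fun j => τ.twoNorm ((k j).1 - a)) atTop (𝓝 0) := by
    refine squeeze_zero (fun _ => τ.twoNorm_nonneg _) (fun j => ?_)
      tendsto_one_div_add_atTop_nhds_zero_nat
    rw [τ.twoNorm_sub_comm]
    change τ.twoNorm (a - StarAlgHom.fst ℂ A N (k j)) ≤ _
    rw [hk1]
    exact (τ.twoNorm_sub_clamp_le ha (hs1 j) le_rfl).trans (hha j)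
  have hcauchy : CauchySeq (fun j => σ.toL2 (k j).2) := by
    have h1 := (tendsto_toL2_iff.2 hlim).cauchySeq
    rw [Metric.cauchySeq_iff] at h1 ⊢
    intro ε hε
    obtain ⟨n, hn⟩ := h1 ε hε
    refine ⟨n, fun i hi j hj => lt_of_eq_of_lt ?_ (hn i hi j hj)⟩
    rw [dist_eq_norm, dist_eq_norm, ← map_sub, ← map_sub, norm_toL2, norm_toL2, twoNorm, twoNorm]
    have := htr _ (mul_mem (star_mem (sub_mem (hkG i) (hkG j))) (sub_mem (hkG i) (hkG j)))
    exact congrArg (fun z : ℂ => √z.re) this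
  obtain ⟨u, -, hu⟩ := hσ (fun j => (k j).2) ‖a‖ (fun _ => Set.mem_univ _)
    (fun j => (norm_snd_le (k j)).trans (hkn j)) hcauchy
  exact ⟨u, k, ‖a‖, hkG, hkn, hlim, hu⟩

theorem exists_snd (hσ : σ.BallComplete Set.univ)
    (hG : IsClosed (G : Set (A × N))) (htr : ∀ g ∈ G, σ g.2 = τ g.1)
    (hdense : ∀ a, ∀ ε > 0, ∃ g ∈ G, τ.twoNorm (a - g.1) < ε) (a : A) :
    ∃ u, GraphClosure τ σ G a u := by
  obtain ⟨u, hu⟩ := exists_of_isSelfAdjoint hσ hG htr hdense (realPart a).2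
  obtain ⟨v, hv⟩ := exists_of_isSelfAdjoint hσ hG htr hdense (imaginaryPart a).2
  refine ⟨u + algebraMap ℂ N Complex.I * v, ?_⟩
  have := hu.add ((scalar Complex.I).mul hv)
  rwa [← Algebra.smul_def, realPart_add_I_smul_imaginaryPart] at this

end GraphClosure

/-- A trace-preserving homomorphism defined on a `2`-norm dense subalgebra extends. The
homomorphism is given by its graph `G`. -/
theorem exists_starAlgHom_of_graph {τ : TracialState A} {σ : TracialState N}
    {G : StarSubalgebra ℂ (A × N)} (hσ : σ.BallComplete Set.univ)
    (hG : IsClosed (G : Set (A × N))) (htr : ∀ g ∈ G, σ g.2 = τ g.1)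
    (hdense : ∀ a, ∀ ε > 0, ∃ g ∈ G, τ.twoNorm (a - g.1) < ε)
    {U : Type*} [Ring U] [StarRing U] [Algebra ℂ U] {υ : TracialState U} (hυ : υ.IsFaithful)
    (π : N →⋆ₐ[ℂ] U) (hπ : ∀ u, υ (π u) = σ u) :
    ∃ ρ : A →⋆ₐ[ℂ] U, (∀ a, υ (ρ a) = τ a) ∧ ∀ g ∈ G, ρ g.1 = π g.2 := by
  choose r hr using GraphClosure.exists_snd hσ hG htr hdense
  -- As `σ` need not be faithful, the partner of `a` is determined only up to 2-norm zero.
  -- Faithfulness of `υ` removes the ambiguity after applying `π`, so the choice `r` becomes a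
  -- homomorphism.
  have huniq : ∀ a u, GraphClosure τ σ G a u → π (r a) = π u := by
    intro a u hu
    refine sub_eq_zero.1 (hυ _ ?_)
    have h0 := (hr a).sub hu
    have h1 := (h0.star.mul h0).apply_eq htr
    rw [← map_sub π, ← StarHomClass.map_star π, ← map_mul π, hπ, h1, sub_self, mul_zero, map_zero]
  refine ⟨{ toFun := fun a => π (r a)
            map_one' := ?_, map_mul' := fun a b => ?_, map_zero' := ?_, map_add' := fun a b => ?_,
            commutes' := fun c => ?_, map_star' := fun a => ?_ }, fun a => ?_, fun g hg => ?_⟩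
  · rw [huniq 1 1 (GraphClosure.of_mem (g := 1) (one_mem G))]
    exact OneHomClass.map_one π
  · rw [huniq _ _ ((hr a).mul (hr b)), map_mul]
  · rw [huniq 0 0 (GraphClosure.of_mem (g := 0) (zero_mem G)), map_zero]
  · rw [huniq _ _ ((hr a).add (hr b)), map_add]
  · rw [huniq _ _ (GraphClosure.scalar c)]
    exact AlgHomClass.commutes π c
  · rw [huniq _ _ (hr a).star, StarHomClass.map_star π]
  · exact (hπ _).trans ((hr a).apply_eq htr)
  · exact huniq _ _ (GraphClosure.of_mem hg)

end TracialState

/-! ### Von Neumann algebras -/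

section Diagonal

variable {H : Type*} [NormedAddCommGroup H] [InnerProductSpace ℂ H]

/-- The diagonal action of an operator on `ℓ²(ℕ, H)`. -/
def diagonalCLM (a : H →L[ℂ] H) : lp (fun _ : ℕ => H) 2 →L[ℂ] lp (fun _ : ℕ => H) 2 :=
  have hb : ∀ f : lp (fun _ : ℕ => H) 2, ∀ i, ‖a (f i)‖ ^ (2 : ℝ≥0∞).toReal ≤
      (‖a‖ * ‖f i‖) ^ (2 : ℝ≥0∞).toReal := fun f i =>
    Real.rpow_le_rpow (norm_nonneg _) (a.le_opNorm _) (by norm_num)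
  have hs : ∀ f : lp (fun _ : ℕ => H) 2,
      HasSum (fun i => (‖a‖ * ‖f i‖) ^ (2 : ℝ≥0∞).toReal) ((‖a‖ * ‖f‖) ^ (2 : ℝ≥0∞).toReal) := by
    intro f
    have := (lp.hasSum_norm (p := 2) (by norm_num) f).mul_left (‖a‖ ^ (2 : ℝ≥0∞).toReal)
    simpa [mul_pow] using this
  LinearMap.mkContinuous
    { toFun := fun f => ⟨fun i => a (f i), memℓp_gen
        ((hs f).summable.of_nonneg_of_le (fun i => by positivity) (hb f))⟩
      map_add' := fun f g => lp.ext (funext fun i => map_add a (f i) (g i))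
      map_smul' := fun c f => lp.ext (funext fun i => map_smul a c (f i)) }
    ‖a‖ (fun f => lp.norm_le_of_tsum_le (p := 2) (by norm_num) (by positivity) (by
      rw [← (hs f).tsum_eq]
      exact ((hs f).summable.of_nonneg_of_le (fun i => by positivity) (hb f)).tsum_le_tsum
        (hb f) (hs f).summable))

theorem diagonalCLM_apply (a : H →L[ℂ] H) (f : lp (fun _ : ℕ => H) 2) (i : ℕ) :
    diagonalCLM a f i = a (f i) := rfl

theorem diagonalCLM_single (a : H →L[ℂ] H) (i : ℕ) (h : H) :
    diagonalCLM a (lp.single 2 i h) = lp.single 2 i (a h) := by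
  refine lp.ext (funext fun j => ?_)
  rw [diagonalCLM_apply]
  rcases eq_or_ne j i with rfl | hj
  · rw [lp.single_apply_self, lp.single_apply_self]
  · rw [lp.single_apply_ne _ _ _ hj, lp.single_apply_ne _ _ _ hj, map_zero]

end Diagonal

section VonNeumann

variable {H : Type*} [NormedAddCommGroup H] [InnerProductSpace ℂ H] [CompleteSpace H]

theorem VonNeumannAlgebra.isClosed (M : VonNeumannAlgebra H) :
    IsClosed (M.toStarSubalgebra : Set (H →L[ℂ] H)) := by
  have h := M.centralizer_centralizer
  rw [VonNeumannAlgebra.coe_toStarSubalgebra, ← h]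
  exact Set.isClosed_centralizer _

/-- A von Neumann algebra is a C*-algebra. -/
@[reducible]
def VonNeumannAlgebra.cstarAlgebra (M : VonNeumannAlgebra H) : CStarAlgebra M.toStarSubalgebra :=
  StarSubalgebra.cstarAlgebra _ (h_closed := M.isClosed)

attribute [local instance] VonNeumannAlgebra.cstarAlgebra

/-- Bounded sequences of operators converge in the weak operator topology along ultrafilters. -/
theorem exists_weak_limit (𝓤 : Ultrafilter ℕ) {u : ℕ → H →L[ℂ] H} {C : ℝ} (hu : ∀ j, ‖u j‖ ≤ C) :
    ∃ T : H →L[ℂ] H, ∀ v w, Tendsto (fun j => inner ℂ v (u j w)) 𝓤 (𝓝 (inner ℂ v (T w))) := by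
  have hbound : ∀ v w j, ‖inner ℂ (u j v) w‖ ≤ C * ‖v‖ * ‖w‖ := fun v w j =>
    (norm_inner_le_norm _ _).trans (mul_le_mul_of_nonneg_right
      (((u j).le_opNorm v).trans (mul_le_mul_of_nonneg_right (hu j) (norm_nonneg v)))
      (norm_nonneg w))
  have hlim : ∀ v w, ∃ z : ℂ, ‖z‖ ≤ C * ‖v‖ * ‖w‖ ∧
      Tendsto (fun j => inner ℂ (u j v) w) 𝓤 (𝓝 z) := by
    intro v w
    have hle : ((𝓤.map (fun j => inner ℂ (u j v) w) : Ultrafilter ℂ) : Filter ℂ) ≤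
        𝓟 (Metric.closedBall (0 : ℂ) (C * ‖v‖ * ‖w‖)) :=
      tendsto_principal.2 (Eventually.of_forall fun j =>
        mem_closedBall_zero_iff.2 (hbound v w j))
    obtain ⟨z, hz, hz'⟩ := (isCompact_closedBall (0 : ℂ) (C * ‖v‖ * ‖w‖)).ultrafilter_le_nhds _ hle
    exact ⟨z, mem_closedBall_zero_iff.1 hz, hz'⟩
  choose f hf hft using hlim
  have huniq : ∀ v w z, Tendsto (fun j => inner ℂ (u j v) w) 𝓤 (𝓝 z) → f v w = z :=
    fun v w z hz => tendsto_nhds_unique (hft v w) hz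
  -- The limits form a bounded sesquilinear form, which the Riesz theorem represents by an operator.
  -- `u j` acts in the first slot because the representing operator appears there.
  let B : H →ₗ⋆[ℂ] H →ₗ[ℂ] ℂ := LinearMap.mk₂'ₛₗ (starRingEnd ℂ) (RingHom.id ℂ) f
    (fun v v' w => huniq _ _ _ (((hft v w).add (hft v' w)).congr fun j => by
      rw [map_add, inner_add_left]))
    (fun c v w => huniq _ _ _ (((hft v w).const_smul (starRingEnd ℂ c)).congr fun j => by
      rw [map_smul, inner_smul_left, smul_eq_mul]))
    (fun v w w' => huniq _ _ _ (((hft v w).add (hft v w')).congr fun j => by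
      rw [inner_add_right]))
    (fun c v w => huniq _ _ _ (((hft v w).const_smul c).congr fun j => by
      rw [inner_smul_right, smul_eq_mul]))
  refine ⟨InnerProductSpace.continuousLinearMapOfBilin (B.mkContinuous₂ C hf), fun v w => ?_⟩
  have h := (Complex.continuous_conj.tendsto _).comp (hft w v)
  rw [← inner_conj_symm, InnerProductSpace.continuousLinearMapOfBilin_apply]
  exact h.congr fun j => inner_conj_symm _ _

/-- Moving `y` across the inner product as its adjoint expresses commutation through matrix
coefficients of `u j`, which pass to the weak limit. -/
theorem mem_centralizer_of_weak_limit {𝓤 : Ultrafilter ℕ} {u : ℕ → H →L[ℂ] H} {T : H →L[ℂ] H}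
    {S : Set (H →L[ℂ] H)} (hu : ∀ j, u j ∈ S.centralizer)
    (hT : ∀ v w, Tendsto (fun j => inner ℂ v (u j w)) 𝓤 (𝓝 (inner ℂ v (T w)))) :
    T ∈ S.centralizer := by
  intro y hy
  ext w
  refine ext_inner_left ℂ fun v => ?_
  refine tendsto_nhds_unique ?_ (hT v (y w))
  have h := hT (ContinuousLinearMap.adjoint y v) w
  rw [ContinuousLinearMap.adjoint_inner_left] at h
  refine h.congr fun j => ?_
  rw [ContinuousLinearMap.adjoint_inner_left]
  have := DFunLike.congr_fun (hu j y hy) w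
  exact congrArg (inner ℂ v) this

/-- Norm-bounded, `2`-norm Cauchy sequences in a von Neumann subalgebra converge. -/
theorem VonNeumannAlgebra.ballComplete {M P : VonNeumannAlgebra H} (hPM : P ≤ M)
    {τ : TracialState M.toStarSubalgebra} (hτ : IsNormalState M τ) :
    τ.BallComplete {a : M.toStarSubalgebra | (a : H →L[ℂ] H) ∈ P} := by
  obtain ⟨ξ, η, hξ, hη, hsum⟩ := hτ
  intro u C huP huC hcauchy
  obtain ⟨T, hT⟩ := exists_weak_limit (hyperfilter ℕ) (u := fun j => (u j : H →L[ℂ] H)) huC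
  have hTP : T ∈ P := by
    rw [← SetLike.mem_coe, ← P.centralizer_centralizer]
    refine mem_centralizer_of_weak_limit (u := fun j => (u j : H →L[ℂ] H)) (fun j => ?_) hT
    rw [P.centralizer_centralizer]
    exact huP j
  set t : M.toStarSubalgebra := ⟨T, hPM hTP⟩ with ht
  -- Here normality enters: `τ (c ·)` is a series of matrix coefficients dominated uniformly on norm
  -- balls, so weak limits pass through it.
  have hcont : ∀ c : M.toStarSubalgebra,
      Tendsto (fun j => τ (c * u j)) (hyperfilter ℕ) (𝓝 (τ (c * t))) := by
    intro c
    have hb : Summable fun i => ‖(c : H →L[ℂ] H)‖ * C * (‖ξ i‖ ^ 2 + ‖η i‖ ^ 2) :=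
      (hξ.add hη).mul_left _
    have hC : 0 ≤ C := (norm_nonneg _).trans (huC 0)
    have key : ∀ y : M.toStarSubalgebra, τ (c * y) =
        ∑' i, inner ℂ (ξ i) ((c : H →L[ℂ] H) ((y : H →L[ℂ] H) (η i))) :=
      fun y => (hsum (c * y)).tsum_eq.symm
    simp_rw [key]
    refine tendsto_tsum_of_dominated_convergence hb (fun i => ?_)
      (Eventually.of_forall fun j i => ?_)
    · simp_rw [← ContinuousLinearMap.adjoint_inner_left (c : H →L[ℂ] H)]
      exact hT _ _
    · have h1 : ‖(u j : H →L[ℂ] H) (η i)‖ ≤ C * ‖η i‖ :=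
        ((u j : H →L[ℂ] H).le_opNorm _).trans (mul_le_mul_of_nonneg_right (huC j) (norm_nonneg _))
      have h2 : ‖(c : H →L[ℂ] H) ((u j : H →L[ℂ] H) (η i))‖ ≤
          ‖(c : H →L[ℂ] H)‖ * (C * ‖η i‖) :=
        ((c : H →L[ℂ] H).le_opNorm _).trans (mul_le_mul_of_nonneg_left h1 (norm_nonneg _))
      have h3 : ‖ξ i‖ * ‖η i‖ ≤ ‖ξ i‖ ^ 2 + ‖η i‖ ^ 2 := by
        nlinarith [sq_nonneg (‖ξ i‖ - ‖η i‖), sq_nonneg ‖ξ i‖, sq_nonneg ‖η i‖]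
      calc _ ≤ ‖ξ i‖ * (‖(c : H →L[ℂ] H)‖ * (C * ‖η i‖)) :=
            (norm_inner_le_norm _ _).trans (mul_le_mul_of_nonneg_left h2 (norm_nonneg _))
        _ = ‖(c : H →L[ℂ] H)‖ * C * (‖ξ i‖ * ‖η i‖) := by ring
        _ ≤ _ := mul_le_mul_of_nonneg_left h3 (mul_nonneg (norm_nonneg _) hC)
  refine ⟨t, hTP, ?_⟩
  rw [Metric.cauchySeq_iff] at hcauchy
  rw [Metric.tendsto_atTop]
  intro ε hε
  obtain ⟨n, hn⟩ := hcauchy (ε / 2) (half_pos hε)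
  refine ⟨n, fun i hi => ?_⟩
  rw [Real.dist_0_eq_abs, abs_of_nonneg (τ.twoNorm_nonneg _)]
  refine lt_of_le_of_lt ?_ (half_lt_self hε)
  -- The Cauchy property upgrades weak to 2-norm convergence: `‖u i - t‖₂²` is the limit over `j` of
  -- these traces, which Cauchy–Schwarz bounds by `‖u i - t‖₂ · ε / 2`; one factor cancels.
  have h1 : Tendsto (fun j => τ (star (u i - t) * (u i - u j))) (hyperfilter ℕ)
      (𝓝 (τ (star (u i - t) * (u i - t)))) := by
    have := (hcont (star (u i - t))).const_sub (τ (star (u i - t) * u i))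
    simpa [mul_sub] using this
  have h2 : ∀ᶠ j in (hyperfilter ℕ : Filter ℕ),
      ‖τ (star (u i - t) * (u i - u j))‖ ≤ τ.twoNorm (u i - t) * (ε / 2) := by
    have : ∀ᶠ j in (hyperfilter ℕ : Filter ℕ), n ≤ j :=
      (Nat.hyperfilter_le_atTop) (eventually_ge_atTop n)
    filter_upwards [this] with j hj
    refine (τ.norm_apply_star_mul_le _ _).trans
      (mul_le_mul_of_nonneg_left ?_ (τ.twoNorm_nonneg _))
    have h3 := hn i hi j hj
    rw [dist_eq_norm, ← map_sub, TracialState.norm_toL2] at h3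
    exact h3.le
  have h3 := le_of_tendsto h1.norm h2
  rw [← τ.twoNorm_sq, Complex.norm_real, Real.norm_of_nonneg (sq_nonneg _), sq] at h3
  by_contra hlt
  push Not at hlt
  have hpos : 0 < τ.twoNorm (u i - t) := (half_pos hε).trans hlt
  exact absurd (le_of_mul_le_mul_left h3 hpos) (not_le.2 hlt)

/-! ### Density of generating subalgebras -/

theorem inner_diagonalCLM (a : H →L[ℂ] H) (f g : lp (fun _ : ℕ => H) 2) :
    inner ℂ (diagonalCLM (star a) f) g = inner ℂ f (diagonalCLM a g) := by
  rw [lp.inner_eq_tsum, lp.inner_eq_tsum]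
  exact tsum_congr fun i => ContinuousLinearMap.adjoint_inner_left a _ _

/-- The density part of the double commutant theorem, on `ℓ²(ℕ, H)`. -/
theorem exists_norm_diagonalCLM_lt (S : StarSubalgebra ℂ (H →L[ℂ] H)) {a : H →L[ℂ] H}
    (ha : a ∈ (S : Set (H →L[ℂ] H)).centralizer.centralizer) (ζ : lp (fun _ : ℕ => H) 2)
    {ε : ℝ} (hε : 0 < ε) : ∃ b ∈ S, ‖diagonalCLM (a - b) ζ‖ < ε := by
  let orb : (H →L[ℂ] H) →ₗ[ℂ] lp (fun _ : ℕ => H) 2 :=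
    { toFun := fun b => diagonalCLM b ζ
      map_add' := fun b c => lp.ext (funext fun i => rfl)
      map_smul' := fun r b => lp.ext (funext fun i => rfl) }
  set K₀ : Submodule ℂ (lp (fun _ : ℕ => H) 2) := S.toSubalgebra.toSubmodule.map orb with hK₀
  set K := K₀.topologicalClosure with hK
  have : CompleteSpace K := (Submodule.isClosed_topologicalClosure _).completeSpace_coe
  set Q := K.starProjection with hQ
  have hinv : ∀ b ∈ S, ∀ f ∈ K, diagonalCLM b f ∈ K := by
    intro b hb f hf
    refine map_mem_closure (f := diagonalCLM b) (diagonalCLM b).continuous hf ?_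
    rintro _ ⟨c, hc, rfl⟩
    exact ⟨b * c, S.mul_mem hb hc, rfl⟩
  have hcomm : ∀ b ∈ S, ∀ f, Q (diagonalCLM b f) = diagonalCLM b (Q f) := by
    intro b hb f
    refine Submodule.eq_starProjection_of_mem_of_inner_eq_zero
      (hinv b hb _ (Submodule.starProjection_apply_mem K f)) fun w hw => ?_
    rw [← map_sub, ← inner_conj_symm, ← inner_diagonalCLM]
    rw [(Submodule.mem_orthogonal _ _).1 (Submodule.sub_starProjection_mem_orthogonal (K := K) f)
      _ (hinv _ (star_mem hb) w hw), map_zero]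
  -- The matrix entries of `Q`. As `Q` commutes with the diagonal action of `S`, every entry lies in
  -- the commutant of `S`; `a` therefore commutes with each entry, and its diagonal action commutes
  -- with `Q`.
  let q : ℕ → ℕ → H →L[ℂ] H := fun i j =>
    (lp.evalCLM ℂ (fun _ : ℕ => H) 2 i).comp
      (Q.comp (lp.singleContinuousLinearMap ℂ (fun _ : ℕ => H) 2 j))
  have hq : ∀ i j h, q i j h = Q (lp.single 2 j h) i := fun i j h => rfl
  have hqc : ∀ i j, q i j ∈ (S : Set (H →L[ℂ] H)).centralizer := by
    intro i j b hb
    ext h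
    change b (q i j h) = q i j (b h)
    rw [hq, hq, ← diagonalCLM_single, hcomm b hb, diagonalCLM_apply]
  have hsingle : ∀ j h, Q (diagonalCLM a (lp.single 2 j h)) = diagonalCLM a (Q (lp.single 2 j h)) := by
    intro j h
    refine lp.ext (funext fun i => ?_)
    rw [diagonalCLM_single, diagonalCLM_apply, ← hq, ← hq]
    exact DFunLike.congr_fun (ha _ (hqc i j)) h
  have hall : Q (diagonalCLM a ζ) = diagonalCLM a (Q ζ) := by
    have h := lp.hasSum_single (p := 2) (by norm_num) ζ
    have h1 := (Q.comp (diagonalCLM a)).hasSum h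
    have h2 := ((diagonalCLM a).comp Q).hasSum h
    refine h1.unique (h2.congr_fun ?_)
    intro j
    exact hsingle j _
  have hζ : ζ ∈ K := subset_closure ⟨1, S.one_mem, lp.ext (funext fun i => rfl)⟩
  have hmem : diagonalCLM a ζ ∈ K := by
    rw [Submodule.starProjection_eq_self_iff.2 hζ] at hall
    rw [← hall]
    exact Submodule.starProjection_apply_mem _ _
  obtain ⟨_, ⟨b, hb, rfl⟩, hlt⟩ := Metric.mem_closure_iff.1
    (show diagonalCLM a ζ ∈ closure (K₀ : Set (lp (fun _ : ℕ => H) 2)) from hmem) ε hε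
  refine ⟨b, hb, ?_⟩
  rw [dist_eq_norm, ← show diagonalCLM (a - b) ζ = diagonalCLM a ζ - orb b from
    lp.ext (funext fun i => rfl)] at hlt
  exact hlt

/-- The `2`-norm of a normal tracial state is dominated by a vector seminorm on `ℓ²(ℕ, H)`. -/
theorem IsNormalState.exists_twoNorm_le {M : VonNeumannAlgebra H}
    {τ : TracialState M.toStarSubalgebra} (hτ : IsNormalState M τ) :
    ∃ ζ : lp (fun _ : ℕ => H) 2, ∀ a : M.toStarSubalgebra,
      τ.twoNorm a ≤ ‖diagonalCLM (a : H →L[ℂ] H) ζ‖ := by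
  obtain ⟨ξ, η, hξ, hη, hsum⟩ := hτ
  let ξ' : lp (fun _ : ℕ => H) 2 := ⟨ξ, memℓp_gen (by simpa using hξ)⟩
  let η' : lp (fun _ : ℕ => H) 2 := ⟨η, memℓp_gen (by simpa using hη)⟩
  -- Polarization gives the witness: the real part of `⟪a ξ, a η⟫` is `(‖a (ξ + η)‖² - ‖a (ξ - η)‖²)
  -- / 4`, at most `‖a (ξ + η)‖²`.
  refine ⟨ξ' + η', fun a => le_of_sq_le_sq ?_ (norm_nonneg _)⟩
  have h1 : τ (star a * a) = inner ℂ (diagonalCLM (a : H →L[ℂ] H) ξ')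
      (diagonalCLM (a : H →L[ℂ] H) η') := by
    rw [lp.inner_eq_tsum, ← (hsum (star a * a)).tsum_eq]
    exact tsum_congr fun i => ContinuousLinearMap.adjoint_inner_right (a : H →L[ℂ] H) _ _
  have h2 : τ.twoNorm a ^ 2 = RCLike.re (inner ℂ (diagonalCLM (a : H →L[ℂ] H) ξ')
      (diagonalCLM (a : H →L[ℂ] H) η')) := by
    rw [← h1, ← τ.twoNorm_sq]; rfl
  rw [h2, re_inner_eq_norm_add_mul_self_sub_norm_sub_mul_self_div_four, ← map_add]
  nlinarith [sq_nonneg ‖diagonalCLM (a : H →L[ℂ] H) (ξ' + η')‖,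
    mul_self_nonneg ‖diagonalCLM (a : H →L[ℂ] H) ξ' - diagonalCLM (a : H →L[ℂ] H) η'‖]

/-- The `*`-algebra generated by self-adjoint generators is `2`-norm dense. -/
theorem GeneratedBy.exists_twoNorm_lt {M : VonNeumannAlgebra H}
    {τ : TracialState M.toStarSubalgebra} (hτ : IsNormalState M τ) {I : Type*}
    {x : I → M.toStarSubalgebra} (hgen : GeneratedBy M x) (a : M.toStarSubalgebra) {ε : ℝ}
    (hε : 0 < ε) : ∃ b ∈ StarAlgebra.adjoin ℂ (Set.range x), τ.twoNorm (a - b) < ε := by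
  obtain ⟨ζ, hζ⟩ := hτ.exists_twoNorm_le
  set S : StarSubalgebra ℂ (H →L[ℂ] H) :=
    (StarAlgebra.adjoin ℂ (Set.range x)).map M.toStarSubalgebra.subtype with hS
  have hSstar : star (S : Set (H →L[ℂ] H)) = S := by
    ext y
    rw [Set.mem_star, SetLike.mem_coe, SetLike.mem_coe, star_mem_iff]
  -- The bicommutant of the generated `*`-algebra is a von Neumann algebra containing the
  -- generators, so minimality puts `M` inside it.
  let N : VonNeumannAlgebra H :=
    { StarSubalgebra.centralizer ℂ (S : Set (H →L[ℂ] H)).centralizer with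
      centralizer_centralizer' := by
        have : ((StarSubalgebra.centralizer ℂ (S : Set (H →L[ℂ] H)).centralizer :
            StarSubalgebra ℂ (H →L[ℂ] H)) : Set (H →L[ℂ] H)) =
            (S : Set (H →L[ℂ] H)).centralizer.centralizer := by
          rw [StarSubalgebra.coe_centralizer, Set.star_centralizer, hSstar, Set.union_self]
        change Set.centralizer (Set.centralizer ((StarSubalgebra.centralizer ℂ
          (S : Set (H →L[ℂ] H)).centralizer : StarSubalgebra ℂ (H →L[ℂ] H)) :
            Set (H →L[ℂ] H))) = _
        rw [this, Set.centralizer_centralizer_centralizer]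
        exact this.symm }
  have hN : (N : Set (H →L[ℂ] H)) = (S : Set (H →L[ℂ] H)).centralizer.centralizer := by
    change ((StarSubalgebra.centralizer ℂ (S : Set (H →L[ℂ] H)).centralizer :
      StarSubalgebra ℂ (H →L[ℂ] H)) : Set (H →L[ℂ] H)) = _
    rw [StarSubalgebra.coe_centralizer, Set.star_centralizer, hSstar, Set.union_self]
  have hMN : M ≤ N := by
    refine hgen N fun i => ?_
    rw [← SetLike.mem_coe, hN]
    exact Set.subset_centralizer_centralizer
      ⟨x i, StarAlgebra.subset_adjoin ℂ _ ⟨i, rfl⟩, rfl⟩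
  have ha : (a : H →L[ℂ] H) ∈ (S : Set (H →L[ℂ] H)).centralizer.centralizer := by
    rw [← hN]
    exact hMN a.2
  obtain ⟨_, ⟨b, hb, rfl⟩, hlt⟩ := exists_norm_diagonalCLM_lt S ha ζ hε
  exact ⟨b, hb, (hζ (a - b)).trans_lt hlt⟩

end VonNeumann

/-! ### Tracial ultraproducts as quotients of `ℓ^∞` products -/

namespace TracialUltraproduct

variable {A : ℕ → Type*} [∀ k, CStarAlgebra (A k)] (τ : ∀ k, TracialState (A k)) (ω : Ultrafilter ℕ)

theorem tendsto_twoNorm (a : boundedSeq A) :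
    Tendsto (fun k => (τ k).twoNorm (a.1 k)) ω (𝓝 ((trace τ ω).twoNorm (mk τ ω a))) := by
  have h := tendsto_limTrace τ ω (star a * a)
  have h2 := ((Complex.continuous_re.tendsto _).comp h).sqrt
  have e : trace τ ω (star (mk τ ω a) * mk τ ω a) = limTrace τ ω (star a * a) := by
    rw [← map_star, ← map_mul]; rfl
  rw [TracialState.twoNorm, e]
  exact h2

/-- The ideal divided out is exactly the kernel of the limiting 2-norm. -/
theorem isFaithful_trace : (trace τ ω).IsFaithful := by
  intro u hu
  obtain ⟨a, rfl⟩ := mk_surjective τ ω u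
  have h := tendsto_twoNorm τ ω a
  rw [TracialState.twoNorm, hu, Complex.zero_re, Real.sqrt_zero] at h
  rw [← map_zero (mk τ ω), mk_eq_iff]
  simpa using h

section Map

variable {B : ℕ → Type*} [∀ k, CStarAlgebra (B k)] {σ : ∀ k, TracialState (B k)}
  {φ : ∀ k, A k →⋆ₐ[ℂ] B k} (hφ : ∀ k a, σ k (φ k a) = τ k a)

theorem trace_map (u : TracialUltraproduct τ ω) :
    trace σ ω (map τ ω σ φ hφ u) = trace τ ω u := by
  obtain ⟨⟨a, C, hC⟩, rfl⟩ := mk_surjective τ ω u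
  rw [map_mk τ ω σ φ hφ a ⟨C, hC⟩
    ⟨C, fun k => (NonUnitalStarAlgHom.norm_apply_le (φ k) (a k)).trans (hC k)⟩]
  refine limTrace_eq σ ω ((tendsto_limTrace τ ω ⟨a, C, hC⟩).congr fun k => ?_)
  exact (hφ k _).symm

theorem map_injective : Function.Injective (map τ ω σ φ hφ) := by
  intro u v huv
  refine sub_eq_zero.1 (isFaithful_trace τ ω _ ?_)
  rw [← trace_map τ ω hφ, map_mul, map_star, map_sub, huv, sub_self, mul_zero, _root_.map_zero]

/-- A sequence of contractive conditional expectations induces one of ultraproducts. -/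
theorem exists_condExp {e : ∀ k, B k →ₗ[ℂ] A k}
    (he : ∀ k, IsTracialCondExp (σ k) (φ k) (e k)) (hen : ∀ k b, ‖e k b‖ ≤ ‖b‖) :
    ∃ F : TracialUltraproduct σ ω →ₗ[ℂ] TracialUltraproduct τ ω,
      IsTracialCondExp (trace σ ω) (map τ ω σ φ hφ) F ∧
      ∀ (b : boundedSeq B) (hb : (fun k => e k (b.1 k)) ∈ boundedSeq A),
        F (mk σ ω b) = mk τ ω ⟨fun k => e k (b.1 k), hb⟩ := by
  have hbdd : ∀ b : boundedSeq B, (fun k => e k (b.1 k)) ∈ boundedSeq A := by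
    rintro ⟨b, C, hC⟩
    exact ⟨C, fun k => (hen k _).trans (hC k)⟩
  let ebar : boundedSeq B → boundedSeq A := fun b => ⟨fun k => e k (b.1 k), hbdd b⟩
  -- Operator-norm contractivity keeps the sequence bounded; 2-norm contractivity, used here, makes
  -- its class independent of the representative.
  have hwd : ∀ b b', mk σ ω b = mk σ ω b' → mk τ ω (ebar b) = mk τ ω (ebar b') := by
    intro b b' h
    rw [mk_eq_iff] at h ⊢
    refine squeeze_zero (fun k => (τ k).twoNorm_nonneg _) (fun k => ?_) h
    have h1 := (he k).twoNorm_le (b.1 k - b'.1 k)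
    rw [TracialState.twoNorm, ← map_star, ← map_mul, hφ, map_sub] at h1
    exact h1
  choose s hs using mk_surjective σ ω
  let F : TracialUltraproduct σ ω → TracialUltraproduct τ ω := fun u => mk τ ω (ebar (s u))
  have hF : ∀ b, F (mk σ ω b) = mk τ ω (ebar b) := fun b => hwd _ _ (hs _)
  refine ⟨{ toFun := F, map_add' := fun u v => ?_, map_smul' := fun c u => ?_ },
    ⟨fun u => ?_, fun u v w => ?_, fun u => ?_⟩, fun b _ => hF b⟩
  · obtain ⟨a, rfl⟩ := mk_surjective σ ω u
    obtain ⟨b, rfl⟩ := mk_surjective σ ω v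
    rw [← map_add, hF, hF, hF, ← map_add]
    exact congrArg _ (Subtype.ext (funext fun k => map_add (e k) _ _))
  · obtain ⟨a, rfl⟩ := mk_surjective σ ω u
    rw [RingHom.id_apply, ← map_smul, hF, hF, ← map_smul]
    exact congrArg _ (Subtype.ext (funext fun k => map_smul (e k) _ _))
  · obtain ⟨⟨a, C, hC⟩, rfl⟩ := mk_surjective τ ω u
    rw [map_mk τ ω σ φ hφ a ⟨C, hC⟩
      ⟨C, fun k => (NonUnitalStarAlgHom.norm_apply_le (φ k) (a k)).trans (hC k)⟩]
    refine (hF _).trans (congrArg _ (Subtype.ext (funext fun k => ?_)))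
    exact (he k).map_incl _
  · obtain ⟨⟨a, C, hC⟩, rfl⟩ := mk_surjective τ ω u
    obtain ⟨⟨c, D, hD⟩, rfl⟩ := mk_surjective τ ω w
    obtain ⟨b, rfl⟩ := mk_surjective σ ω v
    rw [map_mk τ ω σ φ hφ a ⟨C, hC⟩
      ⟨C, fun k => (NonUnitalStarAlgHom.norm_apply_le (φ k) (a k)).trans (hC k)⟩,
      map_mk τ ω σ φ hφ c ⟨D, hD⟩
      ⟨D, fun k => (NonUnitalStarAlgHom.norm_apply_le (φ k) (c k)).trans (hD k)⟩,
      ← map_mul, ← map_mul]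
    change F _ = _ * F _ * _
    rw [hF, hF, ← map_mul, ← map_mul]
    refine congrArg _ (Subtype.ext (funext fun k => ?_))
    exact (he k).map_bimodule _ _ _
  · obtain ⟨b, rfl⟩ := mk_surjective σ ω u
    change trace σ ω (map τ ω σ φ hφ (F _)) = _
    rw [hF, trace_map]
    refine limTrace_eq τ ω ((tendsto_limTrace σ ω b).congr fun k => ?_)
    rw [← (he k).trace_preserving, hφ]

end Map

end TracialUltraproduct

/-- Sequences are truncated by functional calculus in the `ℓ^∞` product, before passing to the
tracial ultraproduct, which is given no norm. -/
instance lp.instCStarAlgebraInfty {A : ℕ → Type*} [∀ k, Nontrivial (A k)]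
    [∀ k, CStarAlgebra (A k)] : CStarAlgebra (lp A ∞) where

namespace TracialUltraproduct

variable {A : ℕ → Type*} [∀ k, Nontrivial (A k)] [∀ k, CStarAlgebra (A k)]
  (τ : ∀ k, TracialState (A k)) (ω : Ultrafilter ℕ)

/-- The quotient map from the `ℓ^∞` product to the tracial ultraproduct. -/
def ofLp : lp A ∞ →⋆ₐ[ℂ] TracialUltraproduct τ ω :=
  (mk τ ω).comp
    { toFun := fun f => ⟨fun k => f k, ‖f‖, fun k => lp.norm_apply_le_norm ENNReal.top_ne_zero f k⟩
      map_one' := rfl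
      map_mul' := fun _ _ => rfl
      map_zero' := rfl
      map_add' := fun _ _ => rfl
      commutes' := fun _ => rfl
      map_star' := fun _ => rfl }

/-- The trace on the `ℓ^∞` product given by the limit along `ω`. -/
def lpTrace : TracialState (lp A ∞) where
  toLinearMap := (trace τ ω).toLinearMap ∘ₗ (ofLp τ ω).toAlgHom.toLinearMap
  map_one' := by
    change trace τ ω (ofLp τ ω 1) = 1
    rw [_root_.map_one (ofLp τ ω), (trace τ ω).map_one]
  nonneg' f := by
    change 0 ≤ trace τ ω (ofLp τ ω (star f * f))
    rw [map_mul, map_star]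
    exact (trace τ ω).nonneg _
  tracial' f g := by
    change trace τ ω (ofLp τ ω (f * g)) = trace τ ω (ofLp τ ω (g * f))
    rw [map_mul (ofLp τ ω), map_mul (ofLp τ ω), (trace τ ω).tracial]

theorem lpTrace_apply (f : lp A ∞) : lpTrace τ ω f = trace τ ω (ofLp τ ω f) := rfl

theorem tendsto_lpTrace (f : lp A ∞) :
    Tendsto (fun k => τ k (f k)) ω (𝓝 (lpTrace τ ω f)) :=
  tendsto_limTrace τ ω ⟨fun k => f k, ‖f‖,
    fun k => lp.norm_apply_le_norm ENNReal.top_ne_zero f k⟩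

theorem twoNorm_lpTrace (f : lp A ∞) :
    (lpTrace τ ω).twoNorm f = (trace τ ω).twoNorm (ofLp τ ω f) := by
  rw [TracialState.twoNorm, TracialState.twoNorm, lpTrace_apply, map_mul, map_star]

theorem tendsto_twoNorm_lp (f : lp A ∞) :
    Tendsto (fun k => (τ k).twoNorm (f k)) ω (𝓝 ((lpTrace τ ω).twoNorm f)) := by
  rw [twoNorm_lpTrace]
  exact tendsto_twoNorm τ ω _

/-- Norm-bounded, `2`-norm Cauchy sequences converge for the trace given by a free ultrafilter. -/
theorem ballComplete_lpTrace (hω : (ω : Filter ℕ) ≤ cofinite) :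
    (lpTrace τ ω).BallComplete Set.univ := by
  classical
  intro u C _ hC hcauchy
  have hC0 : 0 ≤ C := (norm_nonneg _).trans (hC 0)
  set d : ℕ → ℕ → ℝ := fun i j => (lpTrace τ ω).twoNorm (u i - u j) with hd
  -- `Q k m`: at coordinate `k`, the terms up to index `m` are as close as in the limit, up to `1 /
  -- (m + 1)`. Each `m` involves finitely many pairs, so `Q k m` holds for `ω`-most `k`.
  let Q : ℕ → ℕ → Prop := fun k m =>
    ∀ i ≤ m, ∀ j ≤ m, (τ k).twoNorm (u i k - u j k) ≤ d i j + 1 / ((m : ℝ) + 1)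
  have hQ : ∀ m, ∀ᶠ k in (ω : Filter ℕ), Q k m := by
    intro m
    refine (eventually_all_finite (Set.finite_le_nat m)).2 fun i _ => ?_
    refine (eventually_all_finite (Set.finite_le_nat m)).2 fun j _ => ?_
    refine ((tendsto_twoNorm_lp τ ω (u i - u j)).eventually_lt_const ?_).mono fun k hk => hk.le
    exact lt_add_of_pos_right _ (by positivity)
  -- The greatest admissible depth up to `k`; it tends to infinity along `ω` because `ω` is free.
  -- The default value `0` is harmless, since `Q k (m k)` is needed only for `ω`-most `k`. The limit
  -- is the diagonal `k ↦ u (m k) k`.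
  set m : ℕ → ℕ := fun k => Nat.findGreatest (Q k) k with hm
  have hmspec : ∀ n, ∀ᶠ k in (ω : Filter ℕ), n ≤ m k ∧ Q k (m k) := by
    intro n
    have h1 : ∀ᶠ k in (ω : Filter ℕ), n ≤ k :=
      hω (by rw [Nat.cofinite_eq_atTop]; exact eventually_ge_atTop n)
    filter_upwards [h1, hQ n] with k hk1 hk2
    exact ⟨Nat.le_findGreatest hk1 hk2, Nat.findGreatest_spec hk1 hk2⟩
  have hvb : ∀ k, ‖u (m k) k‖ ≤ C := fun k =>
    (lp.norm_apply_le_norm ENNReal.top_ne_zero (u (m k)) k).trans (hC _)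
  let v : lp A ∞ := ⟨fun k => u (m k) k, memℓp_infty ⟨C, by rintro _ ⟨k, rfl⟩; exact hvb k⟩⟩
  refine ⟨v, Set.mem_univ _, ?_⟩
  rw [Metric.cauchySeq_iff] at hcauchy
  rw [Metric.tendsto_atTop]
  intro ε hε
  obtain ⟨n, hn⟩ := hcauchy (ε / 4) (by positivity)
  obtain ⟨n', hn'⟩ := exists_nat_one_div_lt (show (0 : ℝ) < ε / 4 by positivity)
  refine ⟨n, fun i hi => ?_⟩
  rw [Real.dist_0_eq_abs, abs_of_nonneg ((lpTrace τ ω).twoNorm_nonneg _)]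
  refine lt_of_le_of_lt (le_of_tendsto (tendsto_twoNorm_lp τ ω (u i - v)) ?_)
    (half_lt_self hε)
  filter_upwards [hmspec (max (max i n') n)] with k hk
  have h1 := hk.2 i (((le_max_left _ _).trans (le_max_left _ _)).trans hk.1) (m k) le_rfl
  have h2 := hn i hi (m k) ((le_max_right _ _).trans hk.1)
  rw [dist_eq_norm, ← map_sub, TracialState.norm_toL2] at h2
  have h3 : 1 / ((m k : ℝ) + 1) ≤ 1 / ((n' : ℝ) + 1) := by
    have : (n' : ℝ) ≤ m k := by
      exact_mod_cast ((le_max_right _ _).trans (le_max_left _ _)).trans hk.1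
    gcongr
  change (τ k).twoNorm (u i k - u (m k) k) ≤ ε / 2
  have h4 : d i (m k) < ε / 4 := h2
  linarith

end TracialUltraproduct

/-! ### Expectations of bounded random variables -/

namespace Linfty

variable {Ω : Type*} [MeasurableSpace Ω] {μ : Measure Ω} {A : Type*} [CStarAlgebra A]

/-- Evaluation of non-commutative polynomials is pointwise. -/
theorem coeFn_lift {I : Type*} {X : I → Ω → A} {Y : I → Linfty μ A} (h : ∀ i, Y i =ᵐ[μ] X i)
    (p : FreeAlgebra ℂ I) : (FreeAlgebra.lift ℂ Y p : Linfty μ A) =ᵐ[μ]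
      fun w => FreeAlgebra.lift ℂ (fun i => X i w) p := by
  induction p using FreeAlgebra.induction with
  | grade0 r =>
    have h1 : FreeAlgebra.lift ℂ Y (algebraMap ℂ _ r) = (r • (1 : Linfty μ A) : Linfty μ A) := by
      rw [AlgHom.commutes, Algebra.algebraMap_eq_smul_one]
    rw [h1]
    filter_upwards [coeFn_smul r (1 : Linfty μ A), coeFn_one (μ := μ) (A := A)] with w h2 h3
    rw [h2, h3, AlgHom.commutes, Algebra.algebraMap_eq_smul_one]
  | grade1 i =>
    rw [FreeAlgebra.lift_ι_apply]
    filter_upwards [h i] with w hw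
    rw [hw, FreeAlgebra.lift_ι_apply]
  | mul p q hp hq =>
    rw [map_mul]
    filter_upwards [coeFn_mul (FreeAlgebra.lift ℂ Y p) (FreeAlgebra.lift ℂ Y q), hp, hq]
      with w h1 h2 h3
    rw [h1, h2, h3, map_mul]
  | add p q hp hq =>
    rw [map_add]
    filter_upwards [coeFn_add (FreeAlgebra.lift ℂ Y p) (FreeAlgebra.lift ℂ Y q), hp, hq]
      with w h1 h2 h3
    rw [h1, h2, h3, map_add]

variable [IsProbabilityMeasure μ]

/-- The expectation `𝔼 : L^∞(Ω, A) → A`. -/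
def expectation (μ : Measure Ω) (A : Type*) [CStarAlgebra A] [IsProbabilityMeasure μ] :
    Linfty μ A →ₗ[ℂ] A where
  toFun f := ∫ w, f w ∂μ
  map_add' f g := by
    rw [← integral_add f.integrable g.integrable]
    exact integral_congr_ae (coeFn_add f g)
  map_smul' c f := by
    rw [RingHom.id_apply, ← integral_smul]
    exact integral_congr_ae (coeFn_smul c f)

theorem expectation_apply (f : Linfty μ A) : expectation μ A f = ∫ w, f w ∂μ := rfl

theorem norm_expectation_le (f : Linfty μ A) : ‖expectation μ A f‖ ≤ ‖f‖ := by
  have h := norm_integral_le_of_norm_le_const (μ := μ) f.ae_norm_le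
  rwa [probReal_univ, mul_one] at h

/-- The Bochner integral commutes with the continuous linear maps `c ↦ a c b` and `τ`. -/
theorem isTracialCondExp_expectation (τ : TracialState A) :
    IsTracialCondExp (tracialState μ τ) (const μ A) (expectation μ A) where
  map_incl a := by
    rw [expectation_apply, integral_congr_ae (coeFn_const a)]
    simp
  map_bimodule a f b := by
    have h : (const μ A a * f * const μ A b : Linfty μ A) =ᵐ[μ] fun w => a * f w * b := by
      filter_upwards [coeFn_mul (const μ A a * f) (const μ A b), coeFn_mul (const μ A a) f,
        coeFn_const (μ := μ) a, coeFn_const (μ := μ) b] with w h1 h2 h3 h4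
      rw [h1, h2, h3, h4]
    rw [expectation_apply, integral_congr_ae h]
    exact (((ContinuousLinearMap.mul ℂ A).flip b).comp
      (ContinuousLinearMap.mul ℂ A a)).integral_comp_comm f.integrable
  trace_preserving f := by
    rw [tracialState_const]
    exact ((τ.toLinearMap.mkContinuous 1 (fun a => by
      rw [one_mul]; exact τ.norm_apply_le a)).integral_comp_comm f.integrable).symm

/-- Needed for the C*-structure on the `ℓ^∞` product; it holds because a probability measure is
nonzero. -/
instance [Nontrivial A] : Nontrivial (Linfty μ A) := by
  refine ⟨⟨1, 0, fun h => one_ne_zero (α := A) ?_⟩⟩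
  have h1 := coeFn_one (μ := μ) (A := A)
  rw [h] at h1
  obtain ⟨w, hw⟩ := (h1.symm.trans (coeFn_zero (μ := μ) (A := A))).exists
  exact hw

end Linfty

/-! ### Homomorphisms determined by generators -/

/-- Self-adjointness makes the set of generators closed under `star`, so no adjoint variables are
needed. -/
theorem exists_lift_eq_of_mem_adjoin {A : Type*} [Ring A] [StarRing A] [Algebra ℂ A]
    [StarModule ℂ A] {I : Type*} {x : I → A} (hx : ∀ i, IsSelfAdjoint (x i)) {b : A}
    (hb : b ∈ StarAlgebra.adjoin ℂ (Set.range x)) : ∃ p, FreeAlgebra.lift ℂ x p = b := by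
  have hstar : star (Set.range x) = Set.range x := by
    ext a
    rw [Set.mem_star]
    constructor
    · rintro ⟨i, hi⟩
      exact ⟨i, by rw [← star_star a, ← hi, (hx i).star_eq]⟩
    · rintro ⟨i, rfl⟩
      exact ⟨i, (hx i).star_eq.symm⟩
  rw [← StarSubalgebra.mem_toSubalgebra, StarAlgebra.adjoin_toSubalgebra, hstar, Set.union_self,
    Algebra.adjoin_range_eq_range_freeAlgebra_lift] at hb
  exact hb

namespace TracialState

theorem twoNorm_map {A U : Type*} [Ring A] [StarRing A] [Algebra ℂ A]
    [Ring U] [StarRing U] [Algebra ℂ U] {τ : TracialState A} {υ : TracialState U}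
    {ρ : A →⋆ₐ[ℂ] U} (hρ : ∀ a, υ (ρ a) = τ a) (a : A) : υ.twoNorm (ρ a) = τ.twoNorm a := by
  rw [twoNorm, twoNorm, ← StarHomClass.map_star ρ, ← map_mul ρ, hρ]

section Dense

variable {A U : Type*} [Ring A] [StarRing A] [Algebra ℂ A] [StarModule ℂ A]
  [Ring U] [StarRing U] [Algebra ℂ U] [StarModule ℂ U] {τ : TracialState A} {υ : TracialState U}

/-- Trace-preserving homomorphisms that agree on a `2`-norm dense set are equal. -/
theorem starAlgHom_ext_of_dense (hυ : υ.IsFaithful) {S : Set A}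
    (hS : ∀ a, ∀ ε > 0, ∃ b ∈ S, τ.twoNorm (a - b) < ε) {ρ ρ' : A →⋆ₐ[ℂ] U}
    (hρ : ∀ a, υ (ρ a) = τ a) (hρ' : ∀ a, υ (ρ' a) = τ a) (h : ∀ b ∈ S, ρ b = ρ' b) :
    ρ = ρ' := by
  ext a
  refine hυ.eq_of_twoNorm_sub_eq_zero (le_antisymm ?_ (υ.twoNorm_nonneg _))
  refine le_of_forall_pos_lt_add fun ε hε => ?_
  obtain ⟨b, hb, hab⟩ := hS a (ε / 2) (half_pos hε)
  have h1 := υ.twoNorm_sub_triangle (ρ a) (ρ b) (ρ' a)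
  rw [← map_sub ρ, twoNorm_map hρ, h b hb, ← map_sub ρ', twoNorm_map hρ', τ.twoNorm_sub_comm b] at h1
  linarith

/-- Two `2`-norm contractive linear maps with the same `2`-norms on a dense set have the same
`2`-norms everywhere. -/
theorem twoNorm_eq_of_dense {S : Set A}
    (hS : ∀ a, ∀ ε > 0, ∃ b ∈ S, τ.twoNorm (a - b) < ε) {f : A →ₗ[ℂ] U} {g : A →ₗ[ℂ] A}
    (hf : ∀ a, υ.twoNorm (f a) ≤ τ.twoNorm a) (hg : ∀ a, τ.twoNorm (g a) ≤ τ.twoNorm a)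
    (h : ∀ b ∈ S, υ.twoNorm (f b) = τ.twoNorm (g b)) (a : A) :
    υ.twoNorm (f a) = τ.twoNorm (g a) := by
  refine eq_of_abs_sub_nonpos (le_of_forall_pos_lt_add fun ε hε => ?_)
  obtain ⟨b, hb, hab⟩ := hS a (ε / 2) (half_pos hε)
  have h1 := (υ.abs_twoNorm_sub_le (f a) (f b)).trans ((map_sub f a b ▸ hf (a - b) :))
  have h2 := (τ.abs_twoNorm_sub_le (g b) (g a)).trans ((map_sub g b a ▸ hg (b - a) :))
  rw [τ.twoNorm_sub_comm b] at h2
  have h3 := abs_sub_le (υ.twoNorm (f a)) (υ.twoNorm (f b)) (τ.twoNorm (g a))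
  rw [h b hb] at h3 h1
  linarith

end Dense

/-- Generators with the same non-commutative law define a trace-preserving homomorphism. -/
theorem exists_starAlgHom_of_generators {A N : Type*} [CStarAlgebra A] [CStarAlgebra N]
    {τ : TracialState A} {σ : TracialState N} (hσ : σ.BallComplete Set.univ)
    {I : Type*} {x : I → A} {y : I → N} (hx : ∀ i, IsSelfAdjoint (x i))
    (hy : ∀ i, IsSelfAdjoint (y i))
    (hdense : ∀ a, ∀ ε > 0, ∃ b ∈ StarAlgebra.adjoin ℂ (Set.range x), τ.twoNorm (a - b) < ε)
    (htr : ∀ p, σ (FreeAlgebra.lift ℂ y p) = τ (FreeAlgebra.lift ℂ x p))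
    {U : Type*} [Ring U] [StarRing U] [Algebra ℂ U] {υ : TracialState U} (hυ : υ.IsFaithful)
    (π : N →⋆ₐ[ℂ] U) (hπ : ∀ u, υ (π u) = σ u) :
    ∃ ρ : A →⋆ₐ[ℂ] U, (∀ a, υ (ρ a) = τ a) ∧ ∀ i, ρ (x i) = π (y i) := by
  -- The pairs `(p(x), p(y))` form a graph and not necessarily a map: `p(x) = 0` forces only
  -- `‖p(y)‖₂ = 0`. The norm closure makes functional calculus available inside.
  set G₀ : StarSubalgebra ℂ (A × N) :=
    StarAlgebra.adjoin ℂ (Set.range fun i => (x i, y i)) with hG₀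
  set G := G₀.topologicalClosure with hG
  have hz : ∀ i, IsSelfAdjoint ((x i, y i) : A × N) := fun i => Prod.ext (hx i) (hy i)
  have hfst : ∀ p, (FreeAlgebra.lift ℂ (fun i => ((x i, y i) : A × N)) p).1 =
      FreeAlgebra.lift ℂ x p := by
    intro p
    have : (AlgHom.fst ℂ A N).comp (FreeAlgebra.lift ℂ (fun i => ((x i, y i) : A × N))) =
        FreeAlgebra.lift ℂ x := by
      ext i
      simp
    exact DFunLike.congr_fun this p
  have hsnd : ∀ p, (FreeAlgebra.lift ℂ (fun i => ((x i, y i) : A × N)) p).2 =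
      FreeAlgebra.lift ℂ y p := by
    intro p
    have : (AlgHom.snd ℂ A N).comp (FreeAlgebra.lift ℂ (fun i => ((x i, y i) : A × N))) =
        FreeAlgebra.lift ℂ y := by
      ext i
      simp
    exact DFunLike.congr_fun this p
  have hGtr : ∀ g ∈ G, σ g.2 = τ g.1 := by
    have hτc : Continuous τ :=
      (τ.toLinearMap.mkContinuous 1 fun a => by rw [one_mul]; exact τ.norm_apply_le a).continuous
    have hσc : Continuous σ :=
      (σ.toLinearMap.mkContinuous 1 fun a => by rw [one_mul]; exact σ.norm_apply_le a).continuous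
    have hcl : IsClosed {g : A × N | σ g.2 = τ g.1} :=
      isClosed_eq (hσc.comp continuous_snd) (hτc.comp continuous_fst)
    intro g hg
    refine closure_minimal (s := (G₀ : Set (A × N))) ?_ hcl hg
    intro g hg
    obtain ⟨p, rfl⟩ := exists_lift_eq_of_mem_adjoin hz hg
    rw [Set.mem_ofPred_eq, hfst, hsnd, htr]
  have hGle : G₀ ≤ G := G₀.le_topologicalClosure
  have hGdense : ∀ a, ∀ ε > 0, ∃ g ∈ G, τ.twoNorm (a - g.1) < ε := by
    intro a ε hε
    obtain ⟨b, hb, hab⟩ := hdense a ε hε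
    have hmap : (G₀.map (StarAlgHom.fst ℂ A N)) = StarAlgebra.adjoin ℂ (Set.range x) := by
      rw [hG₀, StarAlgHom.map_adjoin, ← Set.range_comp]
      rfl
    rw [← hmap] at hb
    obtain ⟨g, hg, rfl⟩ := hb
    exact ⟨g, hGle hg, hab⟩
  obtain ⟨ρ, hρ, hρG⟩ := exists_starAlgHom_of_graph hσ G₀.isClosed_topologicalClosure hGtr
    hGdense hυ π hπ
  exact ⟨ρ, hρ, fun i => hρG (x i, y i) (hGle (StarAlgebra.subset_adjoin ℂ _ ⟨i, rfl⟩))⟩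

end TracialState

/-- Convergence in probability of uniformly bounded random variables implies convergence of
expectations. -/
theorem tendsto_integral_of_tendstoInMeasure {Ω : Type*} [MeasurableSpace Ω] {μ : Measure Ω}
    [IsProbabilityMeasure μ] {f : ℕ → Ω → ℂ} {c : ℂ} {C : ℝ}
    (hm : ∀ k, AEStronglyMeasurable (f k) μ) (hb : ∀ k, ∀ᵐ w ∂μ, ‖f k w‖ ≤ C)
    (h : TendstoInMeasure μ f atTop (fun _ => c)) :
    Tendsto (fun k => ∫ w, f k w ∂μ) atTop (𝓝 c) := by
  -- Dominated convergence needs almost sure convergence, which convergence in measure provides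
  -- along a further subsequence.
  refine tendsto_of_subseq_tendsto fun ns hns => ?_
  have h' : TendstoInMeasure μ (fun k => f (ns k)) atTop (fun _ => c) :=
    fun ε hε => (h ε hε).comp hns
  obtain ⟨ms, -, hms⟩ := h'.exists_seq_tendsto_ae
  refine ⟨ms, ?_⟩
  have h2 := tendsto_integral_of_dominated_convergence (μ := μ) (F := fun k => f (ns (ms k)))
    (f := fun _ => c) (fun _ => C) (fun k => hm _) (integrable_const C) (fun k => hb _) hms
  simpa using h2

/-! ### The main theorem -/

section Model

variable {n : ℕ → ℕ} {Ω : Type*} [MeasurableSpace Ω] {μ : Measure Ω} {I : Type*}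
  {X : ∀ k, I → Ω → Matrix (Fin (n k)) (Fin (n k)) ℂ}

/-- The random matrices as an element of the `ℓ^∞` product of the algebras
`L^∞(Ω, M_{n(k)}(ℂ))`. -/
def modelSeq (hX : ∀ k i, AEStronglyMeasurable (X k i) μ) {R : I → ℝ}
    (hb : ∀ k i, ∀ᵐ w ∂μ, ‖X k i w‖ ≤ R i) (i : I) :
    lp (fun k => Linfty μ (Matrix (Fin (n k)) (Fin (n k)) ℂ)) ∞ :=
  ⟨fun k => Linfty.ofBounded (X k i) (hX k i) ⟨R i, hb k i⟩, memℓp_infty ⟨|R i|, by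
    rintro _ ⟨k, rfl⟩
    refine Linfty.norm_le (abs_nonneg _) ?_
    filter_upwards [hb k i, Linfty.coeFn_ofBounded (X k i) (hX k i) ⟨R i, hb k i⟩] with w h1 h2
    rw [h2]
    exact h1.trans (le_abs_self _)⟩⟩

variable (hX : ∀ k i, AEStronglyMeasurable (X k i) μ) {R : I → ℝ}
  (hb : ∀ k i, ∀ᵐ w ∂μ, ‖X k i w‖ ≤ R i)

theorem isSelfAdjoint_modelSeq (hsa : ∀ k i, ∀ᵐ w ∂μ, (X k i w).IsHermitian) (i : I) :
    IsSelfAdjoint (modelSeq hX hb i) := by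
  refine lp.ext (funext fun k => Linfty.ext_ae ?_)
  have hc := Linfty.coeFn_ofBounded (X k i) (hX k i) ⟨R i, hb k i⟩
  filter_upwards [Linfty.coeFn_star (modelSeq hX hb i k), hc, hsa k i] with w h1 h2 h3
  exact h1.trans ((congrArg star h2).trans (h3.trans h2.symm))

variable [∀ k, NeZero (n k)] [IsProbabilityMeasure μ]

theorem lift_modelSeq_apply (p : FreeAlgebra ℂ I) (k : ℕ) :
    FreeAlgebra.lift ℂ (modelSeq hX hb) p k =ᵐ[μ]
      fun w => FreeAlgebra.lift ℂ (fun i => X k i w) p := by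
  let ev : lp (fun k => Linfty μ (Matrix (Fin (n k)) (Fin (n k)) ℂ)) ∞ →ₐ[ℂ]
      Linfty μ (Matrix (Fin (n k)) (Fin (n k)) ℂ) :=
    { toFun := fun f => f k
      map_one' := rfl
      map_mul' := fun _ _ => rfl
      map_zero' := rfl
      map_add' := fun _ _ => rfl
      commutes' := fun _ => rfl }
  have h : ev.comp (FreeAlgebra.lift ℂ (modelSeq hX hb)) =
      FreeAlgebra.lift ℂ (fun i => modelSeq hX hb i k) := by
    ext i
    simp only [Function.comp_apply, AlgHom.coe_comp, FreeAlgebra.lift_ι_apply]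
    rfl
  have h2 : FreeAlgebra.lift ℂ (modelSeq hX hb) p k =
      FreeAlgebra.lift ℂ (fun i => modelSeq hX hb i k) p := DFunLike.congr_fun h p
  rw [h2]
  exact Linfty.coeFn_lift (fun i => Linfty.coeFn_ofBounded (X k i) (hX k i) ⟨R i, hb k i⟩) p

/-- The `ℓ^∞` norm of the polynomial in the model bounds the random traces uniformly in `k`, so
convergence in probability passes to expectations. -/
theorem tendsto_trace_lift_modelSeq {A : Type*} [Ring A] [StarRing A] [Algebra ℂ A]
    {τ : TracialState A} {x : I → A} (hlaw : ConvergesInLaw τ x μ X) (p : FreeAlgebra ℂ I) :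
    Tendsto (fun k => Linfty.tracialState μ (matrixTrace (n k))
      (FreeAlgebra.lift ℂ (modelSeq hX hb) p k)) atTop (𝓝 (τ (FreeAlgebra.lift ℂ x p))) := by
  set f := FreeAlgebra.lift ℂ (modelSeq hX hb) p with hf
  have hae := lift_modelSeq_apply hX hb p
  have hcont : ∀ k, Continuous (matrixTrace (n k)) := fun k =>
    ((matrixTrace (n k)).toLinearMap.mkContinuous 1 fun a => by
      rw [one_mul]; exact (matrixTrace (n k)).norm_apply_le a).continuous
  refine (tendsto_integral_of_tendstoInMeasure (C := ‖f‖)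
    (fun k => ?_) (fun k => ?_) (hlaw p)).congr fun k => ?_
  · exact ((hcont k).comp_aestronglyMeasurable (f k).aesm).congr
      ((hae k).mono fun w hw => congrArg (matrixTrace (n k)) hw)
  · filter_upwards [hae k, (f k).ae_norm_le] with w h1 h2
    rw [← h1]
    exact (((matrixTrace (n k)).norm_apply_le _).trans h2).trans
      (lp.norm_apply_le_norm ENNReal.top_ne_zero f k)
  · exact integral_congr_ae ((hae k).mono fun w hw => (congrArg (matrixTrace (n k)) hw).symm)

variable (ω : Ultrafilter ℕ)

theorem ofLp_modelSeq (i : I) :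
    TracialUltraproduct.ofLp (fun k => Linfty.tracialState μ (matrixTrace (n k))) ω
      (modelSeq hX hb i) = modelElement ω hX hb i := rfl

theorem IsInducedEmbedding.map_lift {A : Type*} [Ring A] [StarRing A] [Algebra ℂ A]
    {τ : TracialState A} {x : I → A} {ρ : A →⋆ₐ[ℂ] RandomMatrixUltraproduct n μ ω}
    (hρ : IsInducedEmbedding ω τ x (modelElement ω hX hb) ρ) (p : FreeAlgebra ℂ I) :
    ρ (FreeAlgebra.lift ℂ x p) =
      TracialUltraproduct.ofLp (fun k => Linfty.tracialState μ (matrixTrace (n k))) ω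
        (FreeAlgebra.lift ℂ (modelSeq hX hb) p) := by
  have : ρ.toAlgHom.comp (FreeAlgebra.lift ℂ x) =
      (TracialUltraproduct.ofLp (fun k => Linfty.tracialState μ (matrixTrace (n k))) ω
        ).toAlgHom.comp (FreeAlgebra.lift ℂ (modelSeq hX hb)) := by
    ext i
    simpa using (hρ.map_generator i).trans (ofLp_modelSeq hX hb ω i).symm
  exact DFunLike.congr_fun this p

variable (n μ) in
theorem trace_deterministicInclusion (u : MatrixUltraproduct n ω) :
    randomTrace n μ ω (deterministicInclusion n μ ω u) = TracialUltraproduct.trace _ ω u :=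
  TracialUltraproduct.trace_map _ ω _ u

variable (n μ) in
theorem deterministicInclusion_injective : Function.Injective (deterministicInclusion n μ ω) :=
  TracialUltraproduct.map_injective _ ω _

variable (n μ) in
/-- The conditional expectation onto the deterministic matrices is induced by the expectations. -/
theorem exists_deterministicCondExp :
    ∃ F : RandomMatrixUltraproduct n μ ω →ₗ[ℂ] MatrixUltraproduct n ω,
      IsTracialCondExp (randomTrace n μ ω) (deterministicInclusion n μ ω) F ∧
      ∀ f : lp (fun k => Linfty μ (Matrix (Fin (n k)) (Fin (n k)) ℂ)) ∞,
        F (TracialUltraproduct.ofLp _ ω f) = TracialUltraproduct.mk _ ω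
          ⟨fun k => Linfty.expectation μ (Matrix (Fin (n k)) (Fin (n k)) ℂ) (f k), ‖f‖,
            fun k => (Linfty.norm_expectation_le _).trans
              (lp.norm_apply_le_norm ENNReal.top_ne_zero f k)⟩ := by
  obtain ⟨F, hF, hFmk⟩ := TracialUltraproduct.exists_condExp (fun k => matrixTrace (n k)) ω
    (σ := fun k => Linfty.tracialState μ (matrixTrace (n k)))
    (φ := fun k => Linfty.const μ (Matrix (Fin (n k)) (Fin (n k)) ℂ))
    (fun k a => Linfty.tracialState_const (matrixTrace (n k)) a)
    (fun k => Linfty.isTracialCondExp_expectation (matrixTrace (n k)))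
    (fun k b => Linfty.norm_expectation_le b)
  exact ⟨F, hF, fun f => hFmk _ _⟩

/-- The `2`-norms of the expectations of a polynomial in the model converge along `ω` to the `2`-norm
of its conditional expectation. -/
theorem tendsto_twoNorm_integral {A : Type*} [Ring A] [StarRing A] [Algebra ℂ A]
    {τ : TracialState A} {x : I → A} {ρ : A →⋆ₐ[ℂ] RandomMatrixUltraproduct n μ ω}
    (hρ : IsInducedEmbedding ω τ x (modelElement ω hX hb) ρ)
    {F : RandomMatrixUltraproduct n μ ω →ₗ[ℂ] MatrixUltraproduct n ω}
    (hF : IsTracialCondExp (randomTrace n μ ω) (deterministicInclusion n μ ω) F)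
    (p : FreeAlgebra ℂ I) :
    Tendsto (fun k => (matrixTrace (n k)).twoNorm
      (∫ w, FreeAlgebra.lift ℂ (fun i => X k i w) p ∂μ)) ω
      (𝓝 ((randomTrace n μ ω).twoNorm
        (deterministicInclusion n μ ω (F (ρ (FreeAlgebra.lift ℂ x p)))))) := by
  obtain ⟨F', hF', hF'mk⟩ := exists_deterministicCondExp n μ ω
  -- Uniqueness replaces `F` by the expectation with the explicit formula.
  have hFF : F = F' := IsTracialCondExp.unique (TracialUltraproduct.isFaithful_trace _ ω)
    (deterministicInclusion_injective n μ ω) hF hF'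
  set f := FreeAlgebra.lift ℂ (modelSeq hX hb) p with hf
  rw [TracialState.twoNorm_map (trace_deterministicInclusion n μ ω), hFF,
    hρ.map_lift hX hb ω p, hF'mk]
  refine (TracialUltraproduct.tendsto_twoNorm _ ω _).congr fun k => ?_
  exact congrArg _ (integral_congr_ae (lift_modelSeq_apply hX hb p k))

end Model

end

theorem mainTheorem11
    {H : Type*} [NormedAddCommGroup H] [InnerProductSpace ℂ H] [CompleteSpace H]
    -- the tracial von Neumann algebra `(M, τ)` and the subalgebra `P`
    (M : VonNeumannAlgebra H) (τ : TracialState M.toStarSubalgebra)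
    (hfaithful : τ.IsFaithful) (hnormal : IsNormalState M τ)
    (P : VonNeumannAlgebra H) (hPM : P ≤ M)
    -- self-adjoint generators `x` of `M`
    {I : Type*} (x : I → M.toStarSubalgebra) (hx : ∀ i, IsSelfAdjoint (x i))
    (hgen : GeneratedBy M x)
    (R : I → ℝ) (hR : ∀ i, 0 < R i) (hxR : ∀ i, ‖(x i : H →L[ℂ] H)‖ ≤ R i)
    -- the random matrix models `X k`
    (n : ℕ → ℕ) [∀ k, NeZero (n k)]
    {Ω : Type*} [MeasurableSpace Ω] (μ : Measure Ω) [IsProbabilityMeasure μ]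
    (X : ∀ k, I → Ω → Matrix (Fin (n k)) (Fin (n k)) ℂ)
    (hXmeas : ∀ k i, AEStronglyMeasurable (X k i) μ)
    (hXsa : ∀ k i, ∀ᵐ w ∂μ, (X k i w).IsHermitian)
    (hXR : ∀ k i, ∀ᵐ w ∂μ, ‖X k i w‖ ≤ R i)
    (hXlaw : ConvergesInLaw τ x μ X) :
    -- `E_P`, and for every free ultrafilter `ω` also `ρ_ω` and `E_ω`, exist and are unique
    (∃! E : M.toStarSubalgebra →ₗ[ℂ] P.toStarSubalgebra,
      IsTracialCondExp τ (vnInclusion hPM) E) ∧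
    (∀ ω : Ultrafilter ℕ, (ω : Filter ℕ) ≤ cofinite →
      (∃! ρ : M.toStarSubalgebra →⋆ₐ[ℂ] RandomMatrixUltraproduct n μ ω,
        IsInducedEmbedding ω τ x (modelElement ω hXmeas hXR) ρ) ∧
      (∃! F : RandomMatrixUltraproduct n μ ω →ₗ[ℂ] MatrixUltraproduct n ω,
        IsTracialCondExp (randomTrace n μ ω) (deterministicInclusion n μ ω) F)) ∧
    -- the equivalence
    ∀ E : M.toStarSubalgebra →ₗ[ℂ] P.toStarSubalgebra, IsTracialCondExp τ (vnInclusion hPM) E →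
      (ExternalAveragingProperty τ x (vnInclusion hPM) E μ X ↔
        ∀ ω : Ultrafilter ℕ, (ω : Filter ℕ) ≤ cofinite →
          ∀ ρ : M.toStarSubalgebra →⋆ₐ[ℂ] RandomMatrixUltraproduct n μ ω,
            IsInducedEmbedding ω τ x (modelElement ω hXmeas hXR) ρ →
          ∀ F : RandomMatrixUltraproduct n μ ω →ₗ[ℂ] MatrixUltraproduct n ω,
            IsTracialCondExp (randomTrace n μ ω) (deterministicInclusion n μ ω) F →
          ρ '' Set.range (vnInclusion hPM) =
              Set.range ρ ∩ Set.range (deterministicInclusion n μ ω) ∧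
            ∀ z : M.toStarSubalgebra,
              deterministicInclusion n μ ω (F (ρ z)) = ρ (vnInclusion hPM (E z))) := by
  let _ := M.cstarAlgebra
  have hιinj : Function.Injective (vnInclusion hPM) := fun a b h =>
    Subtype.ext (congrArg (fun y : M.toStarSubalgebra => (y : H →L[ℂ] H)) h)
  have hUfaithful : ∀ ω : Ultrafilter ℕ, (randomTrace n μ ω).IsFaithful := fun ω =>
    TracialUltraproduct.isFaithful_trace _ ω
  have hdense : ∀ a : M.toStarSubalgebra, ∀ ε > 0,
      ∃ b ∈ StarAlgebra.adjoin ℂ (Set.range x), τ.twoNorm (a - b) < ε := fun a ε hε =>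
    hgen.exists_twoNorm_lt hnormal a hε
  have hρext : ∀ ω : Ultrafilter ℕ, (ω : Filter ℕ) ≤ cofinite →
      ∃ ρ : M.toStarSubalgebra →⋆ₐ[ℂ] RandomMatrixUltraproduct n μ ω,
        IsInducedEmbedding ω τ x (modelElement ω hXmeas hXR) ρ := by
    intro ω hω
    -- The auxiliary target is the `ℓ^∞` product with its limit trace; `ofLp` then maps into the
    -- ultraproduct, whose trace is faithful.
    obtain ⟨ρ, hρ1, hρ2⟩ := TracialState.exists_starAlgHom_of_generators
      (TracialUltraproduct.ballComplete_lpTrace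
        (fun k => Linfty.tracialState μ (matrixTrace (n k))) ω hω)
      hx (isSelfAdjoint_modelSeq hXmeas hXR hXsa) hdense
      (fun p => tendsto_nhds_unique (TracialUltraproduct.tendsto_lpTrace _ ω _)
        ((tendsto_trace_lift_modelSeq hXmeas hXR hXlaw p).mono_left
          (hω.trans Nat.cofinite_eq_atTop.le)))
      (hUfaithful ω) (TracialUltraproduct.ofLp _ ω) (fun _ => rfl)
    exact ⟨ρ, hρ1, hρ2⟩
  refine ⟨?_, fun ω hω => ⟨?_, ?_⟩, fun E hE => ⟨fun h ω hω ρ hρ F hF => ?_, fun h p => ?_⟩⟩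
  · set B : StarSubalgebra ℂ M.toStarSubalgebra :=
      P.toStarSubalgebra.comap M.toStarSubalgebra.subtype with hB
    have hBmem : ∀ a : M.toStarSubalgebra, a ∈ B ↔ (a : H →L[ℂ] H) ∈ P := fun a => Iff.rfl
    have hBclosed : IsClosed (B : Set M.toStarSubalgebra) :=
      P.isClosed.preimage continuous_subtype_val
    obtain ⟨E, hE⟩ := IsTracialCondExp.exists_of_orthogonal hfaithful hιinj fun a => by
      obtain ⟨b, hb, hb'⟩ := TracialState.exists_orthogonal B hBclosed
        (VonNeumannAlgebra.ballComplete hPM hnormal) a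
      exact ⟨⟨(b : H →L[ℂ] H), hb⟩, fun c => hb' _ c.2⟩
    exact ⟨E, hE, fun E' hE' => IsTracialCondExp.unique hfaithful hιinj hE' hE⟩
  · obtain ⟨ρ, hρ⟩ := hρext ω hω
    refine ⟨ρ, hρ, fun ρ' hρ' => ?_⟩
    refine TracialState.starAlgHom_ext_of_dense (hUfaithful ω) hdense hρ'.trace_preserving
      hρ.trace_preserving fun b hb => ?_
    obtain ⟨p, rfl⟩ := exists_lift_eq_of_mem_adjoin hx hb
    rw [hρ.map_lift hXmeas hXR ω p, hρ'.map_lift hXmeas hXR ω p]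
  · obtain ⟨F, hF, -⟩ := exists_deterministicCondExp n μ ω
    exact ⟨F, hF, fun F' hF' => IsTracialCondExp.unique (hUfaithful ω)
      (deterministicInclusion_injective n μ ω) hF' hF⟩
  -- (1) ⇒ (2): on polynomials the two 2-norms are limits of the same sequence along `ω`; density
  -- extends their equality to `M`.
  · refine hE.intertwine (hUfaithful ω) hF hρ.trace_preserving ?_
    refine TracialState.twoNorm_eq_of_dense hdense
      (f := (deterministicInclusion n μ ω).toAlgHom.toLinearMap ∘ₗ F ∘ₗ ρ.toAlgHom.toLinearMap)
      (g := (vnInclusion hPM).toAlgHom.toLinearMap ∘ₗ E) (fun a => ?_) (fun a => hE.twoNorm_le a)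
      fun b hb => ?_
    · exact (hF.twoNorm_le (ρ a)).trans (TracialState.twoNorm_map hρ.trace_preserving a).le
    · obtain ⟨p, rfl⟩ := exists_lift_eq_of_mem_adjoin hx hb
      exact tendsto_nhds_unique (tendsto_twoNorm_integral hXmeas hXR ω hρ hF p)
        ((h p).mono_left (hω.trans Nat.cofinite_eq_atTop.le))
  -- (2) ⇒ (1): the ultrafilters below `atTop` on `ℕ` are exactly the free ones. Only the
  -- intertwining relation is used, not the equality of ranges.
  · refine (tendsto_iff_ultrafilter _ _ _).2 fun ω hω => ?_
    have hω' : (ω : Filter ℕ) ≤ cofinite := hω.trans Nat.cofinite_eq_atTop.ge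
    obtain ⟨ρ, hρ⟩ := hρext ω hω'
    obtain ⟨F, hF, -⟩ := exists_deterministicCondExp n μ ω
    have h1 := tendsto_twoNorm_integral hXmeas hXR ω hρ hF p
    rwa [(h ω hω' ρ hρ F hF).2, TracialState.twoNorm_map hρ.trace_preserving] at h1
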